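/- Let $\Bbbk$ be a field and let $k$ be a semisimple ring that is a finite-dimensional $\Bbbk$-algebra (not necessarily commutative). Let $A=\bigoplus_{p\ge 0}A_p$ be a connected graded $k$-algebra, that is, a graded $\Bbbk$-algebra with $A_0=k$, such that the $k$-bimodule $E=A_1$ is finitely generated as a left and as a right $k$-module. Assume that $A$ is Koszul: the left $A$-module $k=A/A_{>0}$ has a graded projective resolution $\cdots\to P^{-2}\to P^{-1}\to P^0\to k\to 0$ in which each $P^{-i}$ is generated as an $A$-module by its degree $i$ component. Let $Q\subseteq E\otimes_k E$ be the kernel of the multiplication $A_1\otimes_k A_1\to A_2$, let $E^*=\operatorname{Hom}_{-k}(E,k)$ be the $k$-bimodule of right $k$-linear maps, with $(a\cdot f)(x)=a f(x)$ and $(f\cdot a)(x)=f(ax)$, and let $Q^\perp\subseteq E^*\otimes_k E^*$ be the set of tensors that vanish on $Q$ under the pairing $(f\otimes g)(e_2\otimes e_1)=f(g(e_2)e_1)$. Let $A^!=T_k(E^*)/(Q^\perp)$ be the quadratic dual of $A$, graded by $T_k(E^*)_i=(E^*)^{\otimes_k i}$. Then for every integer $n\ge 0$ the following are equivalent: 1.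 $A$ has left global dimension $n$; 2. $A$ has right global dimension $n$; 3. $(A^!)^n\ne 0$, and $(A^!)^i=0$ for all $i>n$. No Noetherian hypothesis on $A$ is made. -/

import Mathlib

open scoped TensorProduct MulOpposite

noncomputable section

namespace KoszulDual

universe u

/-! ### Global dimension -/

/-- The left global dimension of a ring: the supremum of the projective dimensions of all left
modules. (It is `⊥` for the zero ring.) The right global dimension of `R` is
`leftGlobalDimension Rᵐᵒᵖ`, since left `Rᵐᵒᵖ`-modules are right `R`-modules. -/
def leftGlobalDimension (R : Type u) [Ring R] : WithBot ℕ∞ :=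
  ⨆ M : ModuleCat.{u} R, CategoryTheory.projectiveDimension M

/-- The right global dimension of a ring. -/
def rightGlobalDimension (R : Type u) [Ring R] : WithBot ℕ∞ :=
  leftGlobalDimension Rᵐᵒᵖ

/-! ### Tensor rings of bimodules

A `𝕜`-central `k`-bimodule is a `𝕜`-vector space `E` with commuting actions of `k` and `kᵐᵒᵖ`
which both extend the action of `𝕜`. -/

section TensorRing

variable (𝕜 k E : Type*) [Field 𝕜] [Ring k] [Algebra 𝕜 k]
  [AddCommGroup E] [Module 𝕜 E] [Module k E] [Module kᵐᵒᵖ E]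

/-- The relations that turn the free `𝕜`-algebra on the vector space `k × E` into the tensor ring
of the `k`-bimodule `E`: the copy of `k` is a subring image, and multiplication of elements of `E`
by elements of `k` is the bimodule structure. -/
inductive TensorRing.Rel : TensorAlgebra 𝕜 (k × E) → TensorAlgebra 𝕜 (k × E) → Prop
  | one : Rel (TensorAlgebra.ι 𝕜 ((1 : k), (0 : E))) 1
  | mul (r s : k) : Rel (TensorAlgebra.ι 𝕜 (r * s, (0 : E)))
      (TensorAlgebra.ι 𝕜 (r, (0 : E)) * TensorAlgebra.ι 𝕜 (s, (0 : E)))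
  | smul_left (r : k) (e : E) : Rel (TensorAlgebra.ι 𝕜 ((0 : k), r • e))
      (TensorAlgebra.ι 𝕜 (r, (0 : E)) * TensorAlgebra.ι 𝕜 ((0 : k), e))
  | smul_right (e : E) (r : k) : Rel (TensorAlgebra.ι 𝕜 ((0 : k), MulOpposite.op r • e))
      (TensorAlgebra.ι 𝕜 ((0 : k), e) * TensorAlgebra.ι 𝕜 (r, (0 : E)))

/-- The tensor ring `T_k(E) = k ⊕ E ⊕ (E ⊗_k E) ⊕ ⋯` of a `k`-bimodule `E`, presented by
generators and relations: it is the universal `𝕜`-algebra with an algebra map from `k` and a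
`k`-bimodule map from `E`. -/
def TensorRing : Type _ := RingQuot (TensorRing.Rel 𝕜 k E)

instance : Ring (TensorRing 𝕜 k E) := inferInstanceAs (Ring (RingQuot (TensorRing.Rel 𝕜 k E)))

instance : Algebra 𝕜 (TensorRing 𝕜 k E) :=
  inferInstanceAs (Algebra 𝕜 (RingQuot (TensorRing.Rel 𝕜 k E)))

namespace TensorRing

/-- The structure map `k → T_k(E)`. -/
def base : k →ₐ[𝕜] TensorRing 𝕜 k E :=
  AlgHom.ofLinearMap
    ((RingQuot.mkAlgHom 𝕜 (Rel 𝕜 k E)).toLinearMap ∘ₗ TensorAlgebra.ι 𝕜 ∘ₗ LinearMap.inl 𝕜 k E)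
    ((RingQuot.mkAlgHom_rel 𝕜 (Rel.one (𝕜 := 𝕜) (k := k) (E := E))).trans (map_one _))
    (fun r s => (RingQuot.mkAlgHom_rel 𝕜 (Rel.mul (𝕜 := 𝕜) (k := k) (E := E) r s)).trans
      (map_mul _ _ _))

/-- The inclusion `E → T_k(E)`. -/
def ι : E →ₗ[𝕜] TensorRing 𝕜 k E :=
  (RingQuot.mkAlgHom 𝕜 (Rel 𝕜 k E)).toLinearMap ∘ₗ TensorAlgebra.ι 𝕜 ∘ₗ LinearMap.inr 𝕜 k E

/-- The map `E ⊗_𝕜 E → T_k(E)`, `e ⊗ e' ↦ e e'`; it factors through `E ⊗_k E`. -/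
def ι₂ : E ⊗[𝕜] E →ₗ[𝕜] TensorRing 𝕜 k E :=
  LinearMap.mul' 𝕜 (TensorRing 𝕜 k E) ∘ₗ TensorProduct.map (ι 𝕜 k E) (ι 𝕜 k E)

/-- The degree `i` component `E ⊗_k ⋯ ⊗_k E` (`i` factors, and `k` for `i = 0`) of `T_k(E)`. -/
def component (i : ℕ) : Submodule 𝕜 (TensorRing 𝕜 k E) :=
  LinearMap.range (base 𝕜 k E).toLinearMap * LinearMap.range (ι 𝕜 k E) ^ i

end TensorRing

variable {E}

/-- The relation on `T_k(E)` which sets the elements of a space of quadratic relations to zero. -/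
inductive QuadraticRing.Rel (Q : Submodule 𝕜 (E ⊗[𝕜] E)) :
    TensorRing 𝕜 k E → TensorRing 𝕜 k E → Prop
  | rel (q : E ⊗[𝕜] E) (hq : q ∈ Q) : Rel Q (TensorRing.ι₂ 𝕜 k E q) 0

/-- The quadratic algebra `T_k(E) / (Q)`. The space of relations in `E ⊗_k E` is given through
a subspace `Q` of `E ⊗_𝕜 E` that maps onto it. -/
def QuadraticRing (Q : Submodule 𝕜 (E ⊗[𝕜] E)) : Type _ := RingQuot (QuadraticRing.Rel 𝕜 k Q)

instance (Q : Submodule 𝕜 (E ⊗[𝕜] E)) : Ring (QuadraticRing 𝕜 k Q) :=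
  inferInstanceAs (Ring (RingQuot (QuadraticRing.Rel 𝕜 k Q)))

instance (Q : Submodule 𝕜 (E ⊗[𝕜] E)) : Algebra 𝕜 (QuadraticRing 𝕜 k Q) :=
  inferInstanceAs (Algebra 𝕜 (RingQuot (QuadraticRing.Rel 𝕜 k Q)))

/-- The projection `T_k(E) → T_k(E) / (Q)`. -/
def QuadraticRing.mk (Q : Submodule 𝕜 (E ⊗[𝕜] E)) : TensorRing 𝕜 k E →ₐ[𝕜] QuadraticRing 𝕜 k Q :=
  RingQuot.mkAlgHom 𝕜 (QuadraticRing.Rel 𝕜 k Q)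

/-- The degree `i` component of `T_k(E) / (Q)`: the image of the degree `i` component of
`T_k(E)`. -/
def QuadraticRing.component (Q : Submodule 𝕜 (E ⊗[𝕜] E)) (i : ℕ) :
    Submodule 𝕜 (QuadraticRing 𝕜 k Q) :=
  (TensorRing.component 𝕜 k E i).map (QuadraticRing.mk 𝕜 k Q).toLinearMap

end TensorRing

/-! ### Duals of bimodules -/

section RightDual

variable (k E : Type*) [Ring k] [AddCommGroup E] [Module kᵐᵒᵖ E]

/-- The dual `E^* = Hom_{-k}(E, k)` of a `k`-bimodule: the right `k`-linear maps `E → k`. -/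
def RightDual : Type _ := E →ₗ[kᵐᵒᵖ] k

namespace RightDual

instance : AddCommGroup (RightDual k E) := inferInstanceAs (AddCommGroup (E →ₗ[kᵐᵒᵖ] k))

instance : FunLike (RightDual k E) E k := inferInstanceAs (FunLike (E →ₗ[kᵐᵒᵖ] k) E k)

instance : AddMonoidHomClass (RightDual k E) E k :=
  inferInstanceAs (AddMonoidHomClass (E →ₗ[kᵐᵒᵖ] k) E k)

variable {k E}

@[ext] theorem ext {f g : RightDual k E} (h : ∀ x, f x = g x) : f = g := DFunLike.ext f g h

theorem map_op_smul (f : RightDual k E) (r : k) (x : E) :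
    f (MulOpposite.op r • x) = f x * r := LinearMap.map_smul f (MulOpposite.op r) x

@[simp] theorem add_apply (f g : RightDual k E) (x : E) : (f + g) x = f x + g x := rfl

/-- The left action `(a • f)(x) = a f(x)`. -/
instance : Module k (RightDual k E) := inferInstanceAs (Module k (E →ₗ[kᵐᵒᵖ] k))

@[simp] theorem smul_apply (a : k) (f : RightDual k E) (x : E) : (a • f) x = a * f x := rfl

section Field

variable {𝕜 : Type*} [Field 𝕜] [Algebra 𝕜 k]

instance : Module 𝕜 (RightDual k E) := inferInstanceAs (Module 𝕜 (E →ₗ[kᵐᵒᵖ] k))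

@[simp] theorem field_smul_apply (c : 𝕜) (f : RightDual k E) (x : E) : (c • f) x = c • f x := rfl

theorem map_field_smul [Module 𝕜 E] [IsScalarTower 𝕜 kᵐᵒᵖ E]
    (f : RightDual k E) (c : 𝕜) (x : E) : f (c • x) = c • f x := by
  have h : c • x = MulOpposite.op (algebraMap 𝕜 k c) • x := by
    rw [← one_smul kᵐᵒᵖ x, ← smul_assoc, ← smul_assoc]
    congr 1
    simp [Algebra.smul_def, ← MulOpposite.op_one, ← MulOpposite.op_mul]
  rw [h, map_op_smul, ← Algebra.commutes, Algebra.smul_def]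

end Field

variable [Module k E] [SMulCommClass k kᵐᵒᵖ E]

/-- The right action `(f • a)(x) = f(a x)`. -/
instance : Module kᵐᵒᵖ (RightDual k E) where
  smul a f := ((f : E →ₗ[kᵐᵒᵖ] k).comp
    ({ toFun := fun x => a.unop • x
       map_add' := fun x y => smul_add _ x y
       map_smul' := fun r x => smul_comm a.unop r x } : E →ₗ[kᵐᵒᵖ] E) : E →ₗ[kᵐᵒᵖ] k)
  one_smul f := ext fun x => congrArg f (one_smul k x)
  mul_smul a b f := ext fun x => congrArg f (mul_smul b.unop a.unop x)
  smul_zero _ := rfl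
  zero_smul f := ext fun x => (congrArg f (zero_smul k x)).trans (map_zero f)
  smul_add _ _ _ := rfl
  add_smul a b f := ext fun x => (congrArg f (add_smul a.unop b.unop x)).trans (map_add f _ _)

@[simp] theorem op_smul_apply (a : k) (f : RightDual k E) (x : E) :
    (MulOpposite.op a • f) x = f (a • x) := rfl

end RightDual

section Perp

variable {k E} {𝕜 : Type*} [Field 𝕜] [Algebra 𝕜 k] [Module 𝕜 E] [Module k E]
  [IsScalarTower 𝕜 k E] [IsScalarTower 𝕜 kᵐᵒᵖ E]

/-- For `f, g ∈ E^*`, the map `E ⊗ E → k`, `e₂ ⊗ e₁ ↦ f(g(e₂) e₁)`. -/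
def pairingOf (f g : RightDual k E) : E ⊗[𝕜] E →ₗ[𝕜] k :=
  TensorProduct.lift <| LinearMap.mk₂ 𝕜 (fun e₂ e₁ => f (g e₂ • e₁))
    (fun x y e => by rw [map_add, add_smul, map_add])
    (fun c x e => by rw [g.map_field_smul, smul_assoc, f.map_field_smul])
    (fun x e e' => by rw [smul_add, map_add])
    (fun c x e => by
      have h : g x • c • e = c • g x • e := by
        rw [← algebraMap_smul k c e, ← algebraMap_smul k c (g x • e), smul_smul, smul_smul,
          Algebra.commutes]
      rw [h, f.map_field_smul])

@[simp] theorem pairingOf_tmul (f g : RightDual k E) (e₂ e₁ : E) :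
    pairingOf (𝕜 := 𝕜) f g (e₂ ⊗ₜ e₁) = f (g e₂ • e₁) := rfl

/-- The natural map `E^* ⊗ E^* → (E ⊗ E)^*`, `(f ⊗ g)(e₂ ⊗ e₁) = f(g(e₂) e₁)`. -/
def pairing : RightDual k E ⊗[𝕜] RightDual k E →ₗ[𝕜] (E ⊗[𝕜] E →ₗ[𝕜] k) :=
  TensorProduct.lift <| LinearMap.mk₂ 𝕜 pairingOf
    (fun f f' g => TensorProduct.ext' fun x y => by simp)
    (fun c f g => TensorProduct.ext' fun x y => by simp)
    (fun f g g' => TensorProduct.ext' fun x y => by simp [add_smul])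
    (fun c f g => TensorProduct.ext' fun x y => by simp [f.map_field_smul])

/-- The orthogonal `Q^⊥`: all tensors in `E^* ⊗ E^*` that vanish on `Q`. Here `Q^⊥` and `Q` are
given through their preimages in the tensor products over `𝕜`. -/
def perp (Q : Submodule 𝕜 (E ⊗[𝕜] E)) : Submodule 𝕜 (RightDual k E ⊗[𝕜] RightDual k E) where
  carrier := {t | ∀ q ∈ Q, pairing (k := k) t q = 0}
  zero_mem' q _ := by simp
  add_mem' {s t} hs ht q hq := by simp [hs q hq, ht q hq]
  smul_mem' c t ht q hq := by simp [ht q hq]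

end Perp

end RightDual

/-! ### Connected graded algebras -/

section Connected

variable {𝕜 k : Type*} {A : Type u} [Field 𝕜] [Ring k] [Algebra 𝕜 k] [Ring A] [Algebra 𝕜 A]
  {𝒜 : ℕ → Submodule 𝕜 A} [GradedAlgebra 𝒜]

/-- The degree one component `E = A₁` of a graded algebra `A` with `A₀ = k`, as a `k`-bimodule.
The isomorphism `φ : k ≃ A₀` is the structure map of the `k`-algebra `A`. -/
def DegreeOne (_φ : k ≃ₐ[𝕜] 𝒜 0) : Type u := 𝒜 1

namespace DegreeOne

variable (φ : k ≃ₐ[𝕜] 𝒜 0)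

instance : AddCommGroup (DegreeOne φ) := inferInstanceAs (AddCommGroup (𝒜 1))

instance : Module 𝕜 (DegreeOne φ) := inferInstanceAs (Module 𝕜 (𝒜 1))

/-- The inclusion `A₁ → A`. -/
def incl : DegreeOne φ →ₗ[𝕜] A := (𝒜 1).subtype

variable {φ}

@[ext] theorem ext {x y : DegreeOne φ} (h : incl φ x = incl φ y) : x = y := Subtype.ext h

theorem incl_mem (x : DegreeOne φ) : incl φ x ∈ 𝒜 1 := Subtype.property (p := (· ∈ 𝒜 1)) x

/-- The left action of `k` on `A₁` by multiplication in `A`. -/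
instance : Module k (DegreeOne φ) where
  smul r x := (⟨(φ r : A) * incl φ x, by
    simpa only [zero_add] using SetLike.mul_mem_graded (φ r).2 (incl_mem x)⟩ : 𝒜 1)
  one_smul x := ext (show (φ 1 : A) * _ = _ by simp)
  mul_smul r s x := ext (show (φ (r * s) : A) * _ = (φ r : A) * ((φ s : A) * _) by
    simp [mul_assoc])
  smul_zero r := ext (show (φ r : A) * _ = _ by simp)
  zero_smul x := ext (show (φ 0 : A) * _ = _ by simp)
  smul_add r x y := ext (show (φ r : A) * _ = (φ r : A) * _ + (φ r : A) * _ by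
    rw [map_add, mul_add])
  add_smul r s x := ext (show (φ (r + s) : A) * _ = (φ r : A) * _ + (φ s : A) * _ by
    simp [add_mul])

/-- The right action of `k` on `A₁` by multiplication in `A`. -/
instance : Module kᵐᵒᵖ (DegreeOne φ) where
  smul r x := (⟨incl φ x * (φ r.unop : A), by
    simpa only [add_zero] using SetLike.mul_mem_graded (incl_mem x) (φ r.unop).2⟩ : 𝒜 1)
  one_smul x := ext (show _ * (φ 1 : A) = _ by simp)
  mul_smul r s x := ext (show _ * (φ (s.unop * r.unop) : A) = (_ * (φ s.unop : A)) * _ by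
    simp [mul_assoc])
  smul_zero r := ext (show _ * (φ r.unop : A) = _ by simp)
  zero_smul x := ext (show _ * (φ 0 : A) = _ by simp)
  smul_add r x y := ext (show _ * (φ r.unop : A) = _ * (φ r.unop : A) + _ * (φ r.unop : A) by
    rw [map_add, add_mul])
  add_smul r s x := ext (show _ * (φ (r.unop + s.unop) : A) =
      _ * (φ r.unop : A) + _ * (φ s.unop : A) by
    simp [mul_add])

@[simp] theorem incl_smul (r : k) (x : DegreeOne φ) : incl φ (r • x) = φ r * incl φ x := rfl

@[simp] theorem incl_op_smul (r : k) (x : DegreeOne φ) :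
    incl φ (MulOpposite.op r • x) = incl φ x * φ r := rfl

instance : SMulCommClass k kᵐᵒᵖ (DegreeOne φ) :=
  ⟨fun r s x => ext (show (φ r : A) * (_ * (φ s.unop : A)) = ((φ r : A) * _) * _ by
    rw [mul_assoc])⟩

instance : IsScalarTower 𝕜 k (DegreeOne φ) :=
  ⟨fun c r x => ext (by simp)⟩

instance : IsScalarTower 𝕜 kᵐᵒᵖ (DegreeOne φ) :=
  ⟨fun c r x => ext (show _ * (φ (c • r.unop) : A) = incl φ (c • (r • x)) by
    rw [map_smul (incl φ)]
    change _ = c • (_ * (φ r.unop : A))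
    simp)⟩

end DegreeOne

variable (φ : k ≃ₐ[𝕜] 𝒜 0)

/-- The quadratic relations of `A`: the kernel of the multiplication `A₁ ⊗ A₁ → A₂`, through its
preimage in `A₁ ⊗_𝕜 A₁`. If `A = T_k(E) / (Q)` with `Q ⊆ E ⊗_k E`, then `E = A₁` and this
kernel is `Q`. -/
def quadraticRelations : Submodule 𝕜 (DegreeOne φ ⊗[𝕜] DegreeOne φ) :=
  LinearMap.ker (LinearMap.mul' 𝕜 A ∘ₗ
    TensorProduct.map (DegreeOne.incl φ) (DegreeOne.incl φ))

/-- The (right) quadratic dual `A^! = T_k(E^*) / (Q^⊥)` of a connected graded `k`-algebra `A`,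
where `E = A₁`, `E^*` is its right dual, and `Q ⊆ E ⊗_k E` are the quadratic relations of `A`. -/
abbrev QuadraticDual : Type _ :=
  QuadraticRing 𝕜 k (perp (k := k) (quadraticRelations φ))

/-- The degree `i` component `(A^!)^i` of the quadratic dual. -/
abbrev QuadraticDual.component (i : ℕ) : Submodule 𝕜 (QuadraticDual φ) :=
  QuadraticRing.component 𝕜 k (perp (k := k) (quadraticRelations φ)) i

variable (𝒜) in
/-- The left ideal `A_{>0} = A₁ ⊕ A₂ ⊕ ⋯`. -/
abbrev positivePart : Submodule A A := (HomogeneousIdeal.irrelevant 𝒜).toIdeal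

variable (𝒜) in
/-- A linear resolution: a resolution `⋯ → P 1 → P 0 → A / A_{>0} → 0` by graded projective left
`A`-modules and maps of degree zero, such that `P i` is generated by its degree `i` component.
(As `A` lives in degrees `≥ 0`, a graded module generated in degree `i ≥ 0` lives in degrees
`≥ i`, so that gradings by `ℕ` are enough.) -/
structure LinearResolution where
  /-- the modules of the resolution -/
  P : ℕ → Type u
  [addCommGroup : ∀ i, AddCommGroup (P i)]
  [module : ∀ i, Module A (P i)]
  /-- `deg i n` is the degree `n` component of `P i` -/
  deg : ∀ i, ℕ → AddSubgroup (P i)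
  isInternal : ∀ i, DirectSum.IsInternal (deg i)
  smul_mem : ∀ i m n (a : A) (x : P i), a ∈ 𝒜 m → x ∈ deg i n → a • x ∈ deg i (m + n)
  projective : ∀ i, Module.Projective A (P i)
  generated : ∀ i, Submodule.span A (deg i i : Set (P i)) = ⊤
  /-- the differential -/
  d : ∀ i, P (i + 1) →ₗ[A] P i
  d_mem : ∀ i n (x : P (i + 1)), x ∈ deg (i + 1) n → d i x ∈ deg i n
  /-- the augmentation -/
  ε : P 0 →ₗ[A] A ⧸ positivePart 𝒜
  ε_mem : ∀ n (x : P 0), x ∈ deg 0 n → ∃ a ∈ 𝒜 n, ε x = (positivePart 𝒜).mkQ a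
  ε_surjective : Function.Surjective ε
  exact_zero : Function.Exact (d 0) ε
  exact_succ : ∀ i, Function.Exact (d (i + 1)) (d i)

variable (𝒜) in
/-- A connected graded algebra `A` is Koszul if the left module `A / A_{>0}` has a linear
resolution. -/
def IsKoszul : Prop := Nonempty (LinearResolution 𝒜)

end Connected

end KoszulDual

end

/-! Let $V_i$ be the degree $i$ component of the $i$-th term $P_i$ of a linear resolution. Each of
the three conditions is translated into the vanishing of the $V_i$.

Projective dimension. Since $P_{i+1}$ lives in degrees $\ge i+1$, the resolution is minimal, and
$A/A_{>0}$ has projective dimension at most $n$ if and only if $V_{n+1}=0$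
(`LinearResolution.hasProjectiveDimensionLT_iff`).

Global dimension. Let $R$ be an $\mathbb N$-graded ring with $R_0$ semisimple, $S$ its opposite,
$X=S/S_{>0}$ and $J=\operatorname{Hom}_{\mathbb Z}(X,\mathbb Q/\mathbb Z)$. If $X$ has projective
dimension at most $n$, then $J$ has injective dimension at most $n$, so
$\operatorname{Ext}^{n+1}_R(-,J)=0$. This vanishing bounds the projective dimension of every
$R$-module, graded or not: write the module as $F/Y$ with $F$ free, filter by degree, and replace
$Y$ by its module of leading forms $\operatorname{lt}Y$. Resolutions of $F/\operatorname{lt}Y$ lift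
to resolutions of $F/Y$ (`ker_gradedCover`). When $\operatorname{Ext}^1(F/\operatorname{lt}Y,J)=0$,
one has $R_{>0}F\cap\operatorname{lt}Y=R_{>0}\operatorname{lt}Y$, and then $Y$ is a direct summand
of $F$ (`projective_quotient_of_lt`). No finiteness enters. Passing from $A$ to $A^{op}$ and back
shows that both global dimensions equal the projective dimension of $A/A_{>0}$.

Quadratic dual. The differential sends $V_{i+1}$ into $A_1V_i$; contraction with $E^*$ gives
operators $E^*\times V_{i+1}\to V_i$. They satisfy the relations $Q^\perp$ because $d^2=0$, and
exactness says that $V_{i+2}$ consists of all solutions of the equations imposed by $Q^\perp$. So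
$V_n$ is the $k$-dual of $(A^!)^n$, with values in $V_0\supseteq k$, and both vanish together
(`quadraticRing_component_eq_bot_iff`). -/

noncomputable section

/-! ### Graded rings, graded free modules and leading forms. -/

namespace KoszulDual

/-- An `ℕ`-grading of a ring, described by its projections onto the homogeneous components. -/
structure NatGrading (R : Type*) [Ring R] where
  /-- the projection onto the component of degree `i` -/
  proj : ℕ → R →+ R
  proj_proj : ∀ i j x, proj i (proj j x) = if i = j then proj j x else 0
  proj_mul : ∀ n a b, proj n (a * b) = ∑ p ∈ Finset.HasAntidiagonal.antidiagonal n, proj p.1 a * proj p.2 b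
  exists_bound : ∀ x, ∃ N, ∀ i, N ≤ i → proj i x = 0
  eq_zero : ∀ x, (∀ i, proj i x = 0) → x = 0
  proj_zero_one : proj 0 1 = 1

namespace NatGrading

variable {R : Type*} [Ring R] (g : NatGrading R)

theorem proj_of_eq {i j : ℕ} {a : R} (ha : g.proj i a = a) : g.proj j a = if j = i then a else 0 := by
  conv_lhs => rw [← ha]
  rw [g.proj_proj, ha]

theorem proj_zero_mul (a b : R) : g.proj 0 (a * b) = g.proj 0 a * g.proj 0 b := by
  simp [g.proj_mul]

theorem proj_mul_of_left {i : ℕ} {a : R} (ha : g.proj i a = a) (n : ℕ) (b : R) :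
    g.proj (i + n) (a * b) = a * g.proj n b := by
  rw [g.proj_mul, Finset.sum_eq_single (i, n)]
  · simp [ha]
  · rintro ⟨p, q⟩ hp hne
    rw [Finset.HasAntidiagonal.mem_antidiagonal] at hp
    rw [g.proj_of_eq ha, if_neg, zero_mul]
    rintro rfl
    exact hne (by simp at hp; simp [hp])
  · simp

/-- The opposite grading. -/
def op : NatGrading Rᵐᵒᵖ where
  proj i := (MulOpposite.opAddEquiv.toAddMonoidHom.comp (g.proj i)).comp
    MulOpposite.opAddEquiv.symm.toAddMonoidHom
  proj_proj i j x := by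
    have := g.proj_proj i j x.unop
    simp only [AddMonoidHom.comp_apply, AddEquiv.coe_toAddMonoidHom, MulOpposite.opAddEquiv_apply,
      MulOpposite.opAddEquiv_symm_apply, MulOpposite.unop_op, this]
    split_ifs <;> simp
  proj_mul n a b := by
    have := g.proj_mul n b.unop a.unop
    simp only [AddMonoidHom.comp_apply, AddEquiv.coe_toAddMonoidHom, MulOpposite.opAddEquiv_apply,
      MulOpposite.opAddEquiv_symm_apply, MulOpposite.unop_mul, this]
    rw [← Finset.Nat.sum_antidiagonal_swap, Finset.op_sum]
    simp
  exists_bound x := by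
    obtain ⟨N, hN⟩ := g.exists_bound x.unop
    exact ⟨N, fun i hi => by simp [hN i hi]⟩
  eq_zero x hx := MulOpposite.unop_injective (g.eq_zero _ fun i => by
    simpa using hx i)
  proj_zero_one := by simp [g.proj_zero_one]

/-- The ideal of elements of positive degree. -/
def pos : Ideal R where
  carrier := {x | g.proj 0 x = 0}
  zero_mem' := map_zero _
  add_mem' {x y} hx hy := by
    rw [Set.mem_ofPred_eq] at *
    rw [map_add, hx, hy, add_zero]
  smul_mem' r x hx := by
    rw [Set.mem_ofPred_eq] at *
    rw [smul_eq_mul, proj_zero_mul, hx, mul_zero]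

theorem mem_pos {x : R} : x ∈ g.pos ↔ g.proj 0 x = 0 := Iff.rfl

theorem mul_mem_pos_left {x : R} (hx : x ∈ g.pos) (y : R) : x * y ∈ g.pos := by
  rw [mem_pos] at *
  rw [proj_zero_mul, hx, zero_mul]

section Free

variable {ι : Type*} (d : ι → ℕ)

/-- The projections of the graded free module on generators `s` of degree `d s`. -/
def top (j : ℕ) : (ι →₀ R) →+ (ι →₀ R) where
  toFun x := Finsupp.onFinset x.support (fun s => if d s ≤ j then g.proj (j - d s) (x s) else 0)
    (fun s hs => Finsupp.mem_support_iff.2 fun h => hs (by simp [h]))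
  map_zero' := by ext; simp
  map_add' x y := by
    ext s
    simp only [Finsupp.onFinset_apply, Finsupp.add_apply, map_add]
    split_ifs <;> simp

theorem top_apply (j : ℕ) (x : ι →₀ R) (s : ι) :
    g.top d j x s = if d s ≤ j then g.proj (j - d s) (x s) else 0 := rfl

theorem top_add_apply (s : ι) (m : ℕ) (x : ι →₀ R) :
    g.top d (d s + m) x s = g.proj m (x s) := by
  rw [top_apply, if_pos (Nat.le_add_right _ _), Nat.add_sub_cancel_left]

theorem top_top (i j : ℕ) (x : ι →₀ R) :
    g.top d i (g.top d j x) = if i = j then g.top d j x else 0 := by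
  ext s
  by_cases hij : i = j
  · subst hij
    simp only [top_apply, if_true]
    split_ifs with h
    · rw [g.proj_proj, if_pos rfl]
    · rfl
  · rw [if_neg hij]
    simp only [top_apply, Finsupp.zero_apply]
    split_ifs with h h'
    · rw [g.proj_proj, if_neg (by omega)]
    · simp
    · rfl

theorem top_eq_zero_ext {x : ι →₀ R} (h : ∀ j, g.top d j x = 0) : x = 0 := by
  ext s
  refine g.eq_zero _ fun i => ?_
  rw [← g.top_add_apply d, h]
  rfl

theorem top_ext {x y : ι →₀ R} (h : ∀ j, g.top d j x = g.top d j y) : x = y := by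
  rw [← sub_eq_zero]
  refine g.top_eq_zero_ext d fun j => ?_
  rw [map_sub, h, sub_self]

theorem exists_top_bound (x : ι →₀ R) : ∃ N, ∀ j, N ≤ j → g.top d j x = 0 := by
  choose N hN using g.exists_bound
  refine ⟨x.support.sup fun s => d s + N (x s), fun j hj => ?_⟩
  ext s
  rw [top_apply, Finsupp.zero_apply]
  split_ifs with h
  · by_cases hs : s ∈ x.support
    · have := (Finset.le_sup (f := fun s => d s + N (x s)) hs).trans hj
      exact hN _ _ (by omega)
    · rw [Finsupp.notMem_support_iff.1 hs, map_zero]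
  · rfl

theorem sum_top {x : ι →₀ R} {N : ℕ} (hN : ∀ j, N ≤ j → g.top d j x = 0) :
    ∑ j ∈ Finset.range N, g.top d j x = x := by
  refine g.top_ext d fun i => ?_
  rw [map_sum]
  simp only [top_top]
  rw [Finset.sum_ite_eq]
  split_ifs with h
  · rfl
  · rw [hN i (by simpa using h)]

theorem mem_of_top_mem {S : Type*} [SetLike S (ι →₀ R)] [AddSubmonoidClass S (ι →₀ R)] (W : S)
    {x : ι →₀ R} (h : ∀ j, g.top d j x ∈ W) : x ∈ W := by
  obtain ⟨N, hN⟩ := g.exists_top_bound d x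
  rw [← g.sum_top d hN]
  exact sum_mem fun j _ => h j

theorem top_smul_of_eq {i : ℕ} {a : R} (ha : g.proj i a = a) (j : ℕ) (x : ι →₀ R) :
    g.top d (i + j) (a • x) = a • g.top d j x := by
  ext s
  rw [Finsupp.smul_apply, top_apply, top_apply, Finsupp.smul_apply, smul_eq_mul, smul_eq_mul]
  by_cases h : d s ≤ j
  · rw [if_pos h, if_pos (by omega), Nat.add_sub_assoc h, g.proj_mul_of_left ha]
  · rw [if_neg h, mul_zero]
    split_ifs with h'
    · rw [g.proj_mul]
      refine Finset.sum_eq_zero fun p hp => ?_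
      rw [Finset.HasAntidiagonal.mem_antidiagonal] at hp
      rw [g.proj_of_eq ha, if_neg (by omega), zero_mul]
    · rfl

theorem top_smul_top (r : R) (i j : ℕ) (x : ι →₀ R) :
    g.top d j (r • g.top d i x) = if i ≤ j then g.proj (j - i) r • g.top d i x else 0 := by
  ext s
  by_cases hij : i ≤ j
  · rw [if_pos hij, Finsupp.smul_apply, top_apply, Finsupp.smul_apply, smul_eq_mul, smul_eq_mul,
      top_apply]
    by_cases h : d s ≤ i
    · rw [if_pos h, if_pos (h.trans hij), g.proj_mul, Finset.sum_eq_single (j - i, i - d s)]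
      · simp [g.proj_proj]
      · rintro ⟨p, q⟩ hp hne
        rw [Finset.HasAntidiagonal.mem_antidiagonal] at hp
        rw [g.proj_proj, if_neg, mul_zero]
        rintro h2
        refine hne (Prod.ext ?_ h2)
        simp only at hp h2 ⊢
        omega
      · intro hp
        rw [Finset.HasAntidiagonal.mem_antidiagonal] at hp
        simp only at hp
        omega
    · rw [if_neg h]
      simp
  · rw [if_neg hij, Finsupp.zero_apply, top_apply, Finsupp.smul_apply, smul_eq_mul, top_apply]
    split_ifs with h h'
    · rw [g.proj_mul]
      refine Finset.sum_eq_zero fun p hp => ?_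
      rw [Finset.HasAntidiagonal.mem_antidiagonal] at hp
      rw [g.proj_proj, if_neg (by omega), mul_zero]
    · simp
    · rfl

/-- The elements of degree at most `j` of the graded free module. -/
def fil (j : ℕ) : AddSubgroup (ι →₀ R) where
  carrier := {x | ∀ i, j < i → g.top d i x = 0}
  zero_mem' _ _ := map_zero _
  add_mem' {x y} hx hy i hi := by rw [map_add, hx i hi, hy i hi, add_zero]
  neg_mem' {x} hx i hi := by rw [map_neg, hx i hi, neg_zero]

theorem exists_mem_fil (x : ι →₀ R) : ∃ j, x ∈ g.fil d j :=
  (g.exists_top_bound d x).imp fun _ hN i hi => hN i hi.le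

theorem top_mem_fil (j : ℕ) (x : ι →₀ R) : g.top d j x ∈ g.fil d j := fun i hi => by
  rw [top_top, if_neg (by omega)]

theorem smul_mem_fil {i : ℕ} {a : R} (ha : g.proj i a = a) {j : ℕ} {x : ι →₀ R}
    (hx : x ∈ g.fil d j) : a • x ∈ g.fil d (i + j) := fun m hm => by
  obtain ⟨l, rfl⟩ := Nat.exists_eq_add_of_le (show i ≤ m by omega)
  rw [g.top_smul_of_eq d ha, hx l (by omega), smul_zero]

theorem eq_zero_of_mem_fil_zero {x : ι →₀ R} (hx : x ∈ g.fil d 0) (h : g.top d 0 x = 0) : x = 0 :=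
  g.top_eq_zero_ext d fun j => by
    rcases j.eq_zero_or_pos with rfl | hj
    · exact h
    · exact hx j hj

theorem mem_fil_of_top_eq_zero {j : ℕ} {x : ι →₀ R} (hx : x ∈ g.fil d (j + 1))
    (h : g.top d (j + 1) x = 0) : x ∈ g.fil d j := fun i hi => by
  rcases Nat.lt_or_eq_of_le (Nat.succ_le_of_lt hi) with h' | rfl
  · exact hx i h'
  · exact h

theorem proj_apply_of_mem_fil {j : ℕ} {x : ι →₀ R} (hx : x ∈ g.fil d j) {s : ι} {m : ℕ}
    (h : j < d s + m) : g.proj m (x s) = 0 := by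
  rw [← g.top_add_apply d, hx _ h]
  rfl

/-- The submodule of leading forms of the elements of a submodule of a graded free module. -/
def lt (Y : Submodule R (ι →₀ R)) : Submodule R (ι →₀ R) :=
  Submodule.span R {z | ∃ j, ∃ y ∈ Y, y ∈ g.fil d j ∧ g.top d j y = z}

theorem top_mem_lt {Y : Submodule R (ι →₀ R)} {j : ℕ} {y : ι →₀ R} (hy : y ∈ Y)
    (hj : y ∈ g.fil d j) : g.top d j y ∈ g.lt d Y := Submodule.subset_span ⟨j, y, hy, hj, rfl⟩

/-- The part of an element of the graded free module in the span of the generators of degree `j`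
over the degree zero component of the ring. -/
def gen (j : ℕ) : (ι →₀ R) →+ (ι →₀ R) where
  toFun x := Finsupp.onFinset x.support (fun s => if d s = j then g.proj 0 (x s) else 0)
    (fun s hs => Finsupp.mem_support_iff.2 fun h => hs (by simp [h]))
  map_zero' := by ext; simp
  map_add' x y := by
    ext s
    simp only [Finsupp.onFinset_apply, Finsupp.add_apply, map_add]
    split_ifs <;> simp

theorem gen_apply (j : ℕ) (x : ι →₀ R) (s : ι) :
    g.gen d j x s = if d s = j then g.proj 0 (x s) else 0 := rfl

/-- `D` strictly lowers the degree of the generators, so it is locally nilpotent and `id + D` is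
unitriangular. Both halves are inductions on a bound for the degrees of the generators that occur in
`x`; such a bound exists even for infinite `ι`. -/
theorem bijective_id_add {D : (ι →₀ R) →ₗ[R] (ι →₀ R)}
    (hD : ∀ s t, d s ≤ d t → D (Finsupp.single s 1) t = 0) :
    Function.Bijective (LinearMap.id + D : (ι →₀ R) →ₗ[R] (ι →₀ R)) := by
  have key : ∀ j (x : ι →₀ R), (∀ t, j + 1 ≤ d t → x t = 0) → ∀ t, j ≤ d t → D x t = 0 := by
    intro j x hx t ht
    rw [← Finsupp.sum_single x, Finsupp.sum, map_sum, Finsupp.finsetSum_apply]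
    refine Finset.sum_eq_zero fun s hs => ?_
    have hs' : ¬ j + 1 ≤ d s := fun h => Finsupp.mem_support_iff.1 hs (hx s h)
    rw [← mul_one (x s), ← smul_eq_mul, ← Finsupp.smul_single, map_smul, Finsupp.smul_apply,
      hD s t (by omega), smul_zero]
  have bound : ∀ x : ι →₀ R, ∃ j, ∀ t, j ≤ d t → x t = 0 := fun x =>
    ⟨x.support.sup d + 1, fun t ht => by
      by_contra h
      have := Finset.le_sup (f := d) (Finsupp.mem_support_iff.2 h)
      omega⟩
  constructor
  · rw [injective_iff_map_eq_zero]
    intro x hx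
    have hx' : ∀ t, x t = - D x t := fun t => by
      have := DFunLike.congr_fun hx t
      simp only [LinearMap.add_apply, LinearMap.id_apply, Finsupp.add_apply,
        Finsupp.zero_apply] at this
      exact eq_neg_of_add_eq_zero_left this
    obtain ⟨j, hj⟩ := bound x
    induction j with
    | zero => ext t; exact hj t (Nat.zero_le _)
    | succ j ih => exact ih fun t ht => by rw [hx' t, key j x hj t ht, neg_zero]
  · intro x
    obtain ⟨j, hj⟩ := bound x
    induction j generalizing x with
    | zero => exact ⟨0, by ext t; simp [hj t (Nat.zero_le _)]⟩
    | succ j ih =>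
      obtain ⟨y, hy⟩ := ih (D x) (key j x hj)
      refine ⟨x - y, ?_⟩
      rw [map_sub, hy]
      simp

end Free

end NatGrading

end KoszulDual

end

/-! ### A criterion, through leading forms, for a submodule of a free module to be a direct summand.
-/

noncomputable section

namespace KoszulDual

/-- Over a semisimple ring every linear map has a generalized inverse. -/
theorem exists_generalizedInverse {K M N : Type*} [Ring K] [IsSemisimpleRing K] [AddCommGroup M]
    [Module K M] [AddCommGroup N] [Module K N] (f : M →ₗ[K] N) :
    ∃ q : N →ₗ[K] M, (∀ x, f (q (f x)) = f x) ∧ ∀ y, q (f (q y)) = q y := by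
  have := Module.projective_of_isSemisimpleRing K (LinearMap.range f)
  obtain ⟨s, hs⟩ := f.rangeRestrict.exists_rightInverse_of_surjective f.range_rangeRestrict
  obtain ⟨W, hW⟩ := exists_isCompl (LinearMap.range f)
  have hs' : ∀ y, f (s y) = y := fun y => congrArg Subtype.val (LinearMap.congr_fun hs y)
  have hp := fun y : LinearMap.range f => Submodule.projectionOnto_apply_left hW y
  refine ⟨s ∘ₗ (LinearMap.range f).projectionOnto W hW, fun x => ?_, fun y => ?_⟩
  · simp only [LinearMap.comp_apply]
    rw [hs']
    exact congrArg Subtype.val (hp ⟨f x, x, rfl⟩)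
  · simp only [LinearMap.comp_apply]
    rw [hs', hp]

namespace NatGrading

variable {R : Type*} [Ring R] (g : NatGrading R) {ι : Type*} (d : ι → ℕ)

/-- If every element of positive degree of `lt Y` which lies in `R_{>0} F` lies in
`R_{>0} lt Y`, then every element of `R_{>0} lt Y` is the leading form of some element of a
given submodule which contains the elements of lower degree of `Y`. -/
theorem exists_top_eq_of_mem_pos_smul {Y W : Submodule R (ι →₀ R)} {j : ℕ}
    (hW : ∀ m < j, ∀ y ∈ Y, y ∈ g.fil d m → y ∈ W) {x : ι →₀ R} (hx : x ∈ g.pos • g.lt d Y) :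
    ∃ y ∈ Y, y ∈ W ∧ y ∈ g.fil d j ∧ g.top d j y = g.top d j x := by
  refine Submodule.smul_induction_on hx ?_ ?_
  · intro r hr z hz
    -- The factor `r` has to vary with the element: for `r • a • z` one passes to `r * a`, which is
    -- again of positive degree.
    refine Submodule.span_induction
      (p := fun z _ => ∀ r ∈ g.pos, ∃ y ∈ Y, y ∈ W ∧ y ∈ g.fil d j ∧ g.top d j y = g.top d j (r • z))
      ?_ ?_ ?_ ?_ hz r hr
    · rintro _ ⟨m, y, hy, hym, rfl⟩ r hr
      rw [top_smul_top]
      -- Only leading forms of degree `m < j` contribute: for `m = j` the coefficient would be the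
      -- degree zero part of `r`, which vanishes. This is why elements of lower degree of `Y`
      -- suffice.
      rcases lt_trichotomy m j with h | rfl | h
      · have hpr : g.proj (j - m) (g.proj (j - m) r) = g.proj (j - m) r := by
          rw [g.proj_proj, if_pos rfl]
        refine ⟨g.proj (j - m) r • y, Y.smul_mem _ hy, W.smul_mem _ (hW m h y hy hym), ?_, ?_⟩
        · have := g.smul_mem_fil d hpr hym
          rwa [Nat.sub_add_cancel h.le] at this
        · have := g.top_smul_of_eq d hpr m y
          rw [Nat.sub_add_cancel h.le] at this
          rw [this, if_pos h.le]
      · refine ⟨0, Y.zero_mem, W.zero_mem, AddSubgroup.zero_mem _, ?_⟩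
        rw [if_pos le_rfl, Nat.sub_self, (g.mem_pos).1 hr, zero_smul, map_zero]
      · exact ⟨0, Y.zero_mem, W.zero_mem, AddSubgroup.zero_mem _, by
          rw [if_neg (by omega), map_zero]⟩
    · intro r _
      exact ⟨0, Y.zero_mem, W.zero_mem, AddSubgroup.zero_mem _, by rw [smul_zero]⟩
    · intro x y _ _ hx hy r hr
      obtain ⟨a, ha, ha', ha'', e⟩ := hx r hr
      obtain ⟨b, hb, hb', hb'', e'⟩ := hy r hr
      exact ⟨a + b, add_mem ha hb, add_mem ha' hb', add_mem ha'' hb'', by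
        rw [smul_add, map_add, map_add, e, e']⟩
    · intro a x _ hx r hr
      rw [smul_smul]
      exact hx _ (g.mul_mem_pos_left hr a)
  · rintro x y ⟨a, ha, ha', ha'', e⟩ ⟨b, hb, hb', hb'', e'⟩
    exact ⟨a + b, add_mem ha hb, add_mem ha' hb', add_mem ha'' hb'', by
      rw [map_add, map_add, e, e']⟩

section Base

variable {K : Type*} [Ring K] [Module K R]

/-- On combinations of degree `j` generators with coefficients of degree zero, an `R`-linear and a
`K`-linear map agree once they agree on the generators. This transports the identities of the
`K`-linear maps `q j` to `R`-linear maps below. -/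
theorem linearCombination_of_gen_eq (hK : ∀ r : R, g.proj 0 r = r → ∃ c : K, c • (1 : R) = r)
    {M : Type*} [AddCommGroup M] [Module R M] [Module K M] [IsScalarTower K R M]
    (q : (ι →₀ R) →ₗ[K] M) {Q : ι → M} {j : ℕ}
    (hQ : ∀ s, d s = j → Q s = q (Finsupp.single s 1)) {x : ι →₀ R} (hx : g.gen d j x = x) :
    Finsupp.linearCombination R Q x = q x := by
  conv_rhs => rw [← Finsupp.sum_single x]
  rw [Finsupp.linearCombination_apply, Finsupp.sum, Finsupp.sum, map_sum]
  refine Finset.sum_congr rfl fun s hs => ?_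
  have hxs := DFunLike.congr_fun hx s
  rw [gen_apply] at hxs
  split_ifs at hxs with h
  · obtain ⟨c, hc⟩ := hK _ hxs
    rw [← hc, smul_one_smul, hQ s h, ← map_smul, Finsupp.smul_single]
  · exact absurd hxs.symm (Finsupp.mem_support_iff.1 hs)

variable [IsScalarTower K R R]

theorem proj_smul_base (hK : ∀ c : K, g.proj 0 (c • (1 : R)) = c • (1 : R)) (c : K) (i : ℕ)
    (x : R) : g.proj i (c • x) = c • g.proj i x := by
  have := g.proj_mul_of_left (hK c) i x
  rwa [zero_add, smul_one_mul, smul_one_mul] at this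

/-- `gen` is linear over the degree zero component. -/
def genLinear (hK : ∀ c : K, g.proj 0 (c • (1 : R)) = c • (1 : R)) (j : ℕ) :
    (ι →₀ R) →ₗ[K] (ι →₀ R) where
  __ := g.gen d j
  map_smul' c x := by
    ext s
    change g.gen d j (c • x) s = c • g.gen d j x s
    simp only [gen_apply, Finsupp.smul_apply, g.proj_smul_base hK]
    split_ifs <;> simp

theorem genLinear_apply (hK : ∀ c : K, g.proj 0 (c • (1 : R)) = c • (1 : R)) (j : ℕ)
    (x : ι →₀ R) : g.genLinear d hK j x = g.gen d j x := rfl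

theorem gen_gen (j : ℕ) (x : ι →₀ R) : g.gen d j (g.gen d j x) = g.gen d j x := by
  ext s
  simp only [gen_apply]
  split_ifs
  · rw [g.proj_proj, if_pos rfl]
  · rfl

/-- The elements of degree at most `j` of a submodule, as a module over the degree zero
component. -/
def filSub (hK : ∀ c : K, g.proj 0 (c • (1 : R)) = c • (1 : R)) (Y : Submodule R (ι →₀ R))
    (j : ℕ) : Submodule K (ι →₀ R) where
  carrier := {y | y ∈ Y ∧ y ∈ g.fil d j}
  zero_mem' := ⟨Y.zero_mem, AddSubgroup.zero_mem _⟩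
  add_mem' hx hy := ⟨add_mem hx.1 hy.1, add_mem hx.2 hy.2⟩
  smul_mem' c x hx := by
    rw [← smul_one_smul R c x]
    refine ⟨Y.smul_mem _ hx.1, ?_⟩
    have := g.smul_mem_fil d (hK c) hx.2
    rwa [zero_add] at this

/-- A submodule `Y` of a graded free module such that `R_{>0} F ∩ lt Y = R_{>0} lt Y` is a direct
summand. -/
theorem projective_quotient_of_lt [IsSemisimpleRing K]
    (hK : ∀ c : K, g.proj 0 (c • (1 : R)) = c • (1 : R))
    (hK' : ∀ r : R, g.proj 0 r = r → ∃ c : K, c • (1 : R) = r) (Y : Submodule R (ι →₀ R))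
    (hY : ∀ x ∈ g.lt d Y, (∀ s, x s ∈ g.pos) → x ∈ g.pos • g.lt d Y) :
    Module.Projective R ((ι →₀ R) ⧸ Y) := by
  -- `q j` picks, linearly over `K`, elements of `Y` of degree at most `j` with prescribed generator
  -- part of degree `j`, as far as such elements exist. Semisimplicity of `K` is used only here.
  choose q hq hq' using fun j => exists_generalizedInverse
    (M := g.filSub d hK Y j) ((g.genLinear d hK j).comp (g.filSub d hK Y j).subtype)
  simp only [LinearMap.comp_apply, Submodule.subtype_apply, genLinear_apply] at hq hq'
  let ρ : (ι →₀ R) →ₗ[R] (ι →₀ R) :=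
    Finsupp.linearCombination R fun s => (q (d s) (Finsupp.single s 1) : ι →₀ R)
  let π : (ι →₀ R) →ₗ[R] (ι →₀ R) :=
    Finsupp.linearCombination R fun s => g.gen d (d s) (q (d s) (Finsupp.single s 1))
  have hρs : ∀ s, ρ (Finsupp.single s 1) = q (d s) (Finsupp.single s 1) := fun s => by
    simp [ρ]
  have hπs : ∀ s, π (Finsupp.single s 1) = g.gen d (d s) (q (d s) (Finsupp.single s 1)) :=
    fun s => by simp [π]
  have hρ : ∀ j x, g.gen d j x = x → ρ x = q j x := fun j x hx =>
    g.linearCombination_of_gen_eq d hK' ((g.filSub d hK Y j).subtype.comp (q j))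
      (by rintro s rfl; rfl) hx
  have hπ : ∀ j x, g.gen d j x = x → π x = g.gen d j (q j x) := fun j x hx =>
    g.linearCombination_of_gen_eq d hK'
      ((g.genLinear d hK j).comp ((g.filSub d hK Y j).subtype.comp (q j)))
      (by rintro s rfl; rfl) hx
  have hρπ : ∀ x, ρ (π x) = ρ x := by
    have : ρ ∘ₗ π = ρ := Finsupp.lhom_ext' fun s => LinearMap.ext_ring <| by
      change ρ (π (Finsupp.single s 1)) = ρ (Finsupp.single s 1)
      rw [hπs, hρ (d s) _ (g.gen_gen d _ _), hq', hρs]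
    exact LinearMap.congr_fun this
  have hππ : ∀ x, π (π x) = π x := by
    have : π ∘ₗ π = π := Finsupp.lhom_ext' fun s => LinearMap.ext_ring <| by
      change π (π (Finsupp.single s 1)) = π (Finsupp.single s 1)
      rw [hπs, hπ (d s) _ (g.gen_gen d _ _), hq']
    exact LinearMap.congr_fun this
  -- As `ρ` sends the generator `s` to an element of degree at most `d s`, its coordinates vanish at
  -- generators of larger degree and have degree zero at those of degree `d s`. `π` subtracts
  -- exactly the latter, so `ρ - π` is strictly triangular.
  have hθ : Function.Bijective (LinearMap.id + (ρ - π) : (ι →₀ R) →ₗ[R] (ι →₀ R)) := by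
    refine bijective_id_add d fun s t hst => ?_
    rw [LinearMap.sub_apply, hρs, hπs, Finsupp.sub_apply, gen_apply]
    have hm := (q (d s) (Finsupp.single s 1)).2.2
    split_ifs with h
    · rw [sub_eq_zero]
      have key : ∀ i, g.proj i ((q (d s) (Finsupp.single s 1) : ι →₀ R) t) =
          g.proj i (g.proj 0 ((q (d s) (Finsupp.single s 1) : ι →₀ R) t)) := fun i => by
        rw [g.proj_proj]
        split_ifs with hi
        · rw [hi]
        · exact g.proj_apply_of_mem_fil d hm (by omega)
      rw [← sub_eq_zero]
      refine g.eq_zero _ fun i => ?_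
      rw [map_sub, sub_eq_zero]
      exact key i
    · rw [sub_zero]
      exact g.eq_zero _ fun i => g.proj_apply_of_mem_fil d hm (by omega)
  let θ := LinearEquiv.ofBijective _ hθ
  have hθ_apply : ∀ x, θ x = x + (ρ x - π x) := fun x => rfl
  -- The automorphism `θ` carries the image of the idempotent `π` onto the image of `ρ`, which is
  -- therefore a direct summand. It remains to see that this image is `Y`.
  have hθπ : ∀ x, θ.symm (ρ x) = π x := fun x => by
    rw [LinearEquiv.symm_apply_eq, hθ_apply, hρπ, hππ]
    abel
  have hρY : ∀ x, ρ x ∈ Y := fun x => by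
    change Finsupp.linearCombination R _ x ∈ Y
    rw [Finsupp.linearCombination_apply]
    exact Submodule.sum_mem _ fun s _ => Y.smul_mem _ (q (d s) (Finsupp.single s 1)).2.1
  have hYρ : ∀ j, ∀ y ∈ Y, y ∈ g.fil d j → y ∈ LinearMap.range ρ := by
    intro j
    induction j using Nat.strong_induction_on with
    | _ j ih =>
      -- Subtracting `ρ (g.gen d j y)` kills the generator part of degree `j`, because `gen ∘ q ∘
      -- gen = gen` on `Y`.
      suffices H : ∀ y ∈ Y, y ∈ g.fil d j → g.gen d j y = 0 → y ∈ LinearMap.range ρ by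
        intro y hy hyj
        have hz : ρ (g.gen d j y) = q j (g.gen d j y) := hρ j _ (g.gen_gen d _ _)
        have h1 := H (y - ρ (g.gen d j y)) (sub_mem hy (hρY _))
          (sub_mem hyj (hz ▸ (q j (g.gen d j y)).2.2)) (by
            rw [map_sub, hz, sub_eq_zero]
            exact (hq j ⟨y, hy, hyj⟩).symm)
        have := add_mem h1 (LinearMap.mem_range_self ρ (g.gen d j y))
        rwa [sub_add_cancel] at this
      intro y hy hyj hgen
      -- Without generator part, the leading form of `y` lies in `R_{>0} F`, hence in `R_{>0} lt Y`;
      -- it is then also the leading form of a combination of elements of `Y` of lower degree,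
      -- already known to be in the range of `ρ`.
      have hlt := hY _ (g.top_mem_lt d hy hyj) fun s => by
        rw [mem_pos, top_apply]
        split_ifs with h
        · rw [g.proj_proj]
          split_ifs with h'
          · have := DFunLike.congr_fun hgen s
            rw [gen_apply, if_pos (by omega)] at this
            rw [← h']
            exact this
          · rfl
        · exact map_zero _
      obtain ⟨z, hzY, hzρ, hzj, hz⟩ := g.exists_top_eq_of_mem_pos_smul d
        (W := LinearMap.range ρ) ih hlt
      rw [top_top, if_pos rfl] at hz
      have hsub : y - z ∈ LinearMap.range ρ := by
        have h0 : g.top d j (y - z) = 0 := by rw [map_sub, hz, sub_self]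
        have hm : y - z ∈ g.fil d j := sub_mem hyj hzj
        rcases j with _ | j
        · rw [g.eq_zero_of_mem_fil_zero d hm h0]
          exact zero_mem _
        · exact ih j (Nat.lt_succ_self j) _ (sub_mem hy hzY) (g.mem_fil_of_top_eq_zero d hm h0)
      have := add_mem hsub hzρ
      rwa [sub_add_cancel] at this
  -- A retraction of the free module onto `Y`; `id - r` then splits the quotient map.
  let r : (ι →₀ R) →ₗ[R] (ι →₀ R) := ρ ∘ₗ θ.symm.toLinearMap
  have hr : ∀ y ∈ Y, r y = y := fun y hy => by
    obtain ⟨j, hj⟩ := g.exists_mem_fil d y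
    obtain ⟨x, rfl⟩ := hYρ j y hy hj
    change ρ (θ.symm (ρ x)) = ρ x
    rw [hθπ, hρπ]
  refine Module.Projective.of_split (M := ι →₀ R)
    (Y.liftQ (LinearMap.id - r) fun y hy => by
      rw [LinearMap.mem_ker, LinearMap.sub_apply, LinearMap.id_apply, hr y hy, sub_self])
    Y.mkQ ?_
  refine Submodule.linearMap_qext _ (LinearMap.ext fun x => ?_)
  change Y.mkQ (x - r x) = Y.mkQ x
  rw [map_sub, sub_eq_self]
  exact (Submodule.Quotient.mk_eq_zero Y).2 (hρY _)

end Base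

end NatGrading

end KoszulDual

end

/-! ### Character modules: from projective dimension over the opposite ring to injective dimension.
-/

noncomputable section

namespace KoszulDual

universe u

open CategoryTheory

section CharDual

variable {R S : Type u} [Ring R] [Ring S]

/-- The character module `Hom_ℤ(X, ℚ/ℤ)` of a left module `X` over `S ≃ Rᵐᵒᵖ`, as a left
`R`-module. -/
def CharDual (_e : R ≃+* Sᵐᵒᵖ) (X : Type u) [AddCommGroup X] : Type u := CharacterModule X

namespace CharDual

variable (e : R ≃+* Sᵐᵒᵖ) (X : Type u) [AddCommGroup X]

instance : AddCommGroup (CharDual e X) := inferInstanceAs (AddCommGroup (CharacterModule X))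

instance : FunLike (CharDual e X) X (AddCircle (1 : ℚ)) :=
  inferInstanceAs (FunLike (CharacterModule X) X (AddCircle (1 : ℚ)))

instance : AddMonoidHomClass (CharDual e X) X (AddCircle (1 : ℚ)) :=
  inferInstanceAs (AddMonoidHomClass (X →+ AddCircle (1 : ℚ)) X (AddCircle (1 : ℚ)))

variable {e X}

@[ext] theorem ext {f f' : CharDual e X} (h : ∀ x, f x = f' x) : f = f' := DFunLike.ext f f' h

/-- An additive map to `ℚ/ℤ` as an element of the character module. -/
def mk (f : X →+ AddCircle (1 : ℚ)) : CharDual e X := f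

variable [Module S X]

instance : Module R (CharDual e X) where
  smul r f := mk ((f : X →+ AddCircle (1 : ℚ)).comp (DistribSMul.toAddMonoidHom X (e r).unop))
  one_smul f := ext fun x => show f ((e 1).unop • x) = f x by simp
  mul_smul r r' f := ext fun x => show f ((e (r * r')).unop • x) =
    f ((e r').unop • (e r).unop • x) by simp [mul_smul]
  smul_zero r := rfl
  zero_smul f := ext fun x => show f ((e 0).unop • x) = 0 by simp
  smul_add r f f' := rfl
  add_smul r r' f := ext fun x => show f ((e (r + r')).unop • x) =
    f ((e r).unop • x) + f ((e r').unop • x) by simp [add_smul]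

theorem smul_apply (r : R) (f : CharDual e X) (x : X) : (r • f) x = f ((e r).unop • x) := rfl

variable (e) in
/-- The dual of a linear map. -/
def map {X Y : Type u} [AddCommGroup X] [Module S X] [AddCommGroup Y] [Module S Y]
    (f : X →ₗ[S] Y) : CharDual e Y →ₗ[R] CharDual e X where
  toFun h := mk ((h : Y →+ AddCircle (1 : ℚ)).comp f.toAddMonoidHom)
  map_add' _ _ := rfl
  map_smul' r h := ext fun x => show h ((e r).unop • f x) = h (f ((e r).unop • x)) by
    rw [f.map_smul]

theorem map_apply {X Y : Type u} [AddCommGroup X] [Module S X] [AddCommGroup Y] [Module S Y]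
    (f : X →ₗ[S] Y) (h : CharDual e Y) (x : X) : map e f h x = h (f x) := rfl

theorem map_injective {X Y : Type u} [AddCommGroup X] [Module S X] [AddCommGroup Y] [Module S Y]
    {f : X →ₗ[S] Y} (hf : Function.Surjective f) : Function.Injective (map e f) :=
  fun h h' hh => ext fun y => by
    obtain ⟨x, rfl⟩ := hf y
    exact DFunLike.congr_fun hh x

theorem exists_extension {X Y : Type u} [AddCommGroup X] [AddCommGroup Y]
    (f : X →+ Y) (hf : Function.Injective f) (h : X →+ AddCircle (1 : ℚ)) :
    ∃ h' : Y →+ AddCircle (1 : ℚ), ∀ x, h' (f x) = h x := by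
  obtain ⟨h', hh'⟩ := CharacterModule.dual_surjective_of_injective (R := ℤ) f.toIntLinearMap hf h
  exact ⟨h', fun x => DFunLike.congr_fun hh' x⟩

theorem map_surjective {X Y : Type u} [AddCommGroup X] [Module S X] [AddCommGroup Y] [Module S Y]
    {f : X →ₗ[S] Y} (hf : Function.Injective f) : Function.Surjective (map e f) := fun h => by
  obtain ⟨h', hh'⟩ := exists_extension f.toAddMonoidHom hf (h : X →+ AddCircle (1 : ℚ))
  exact ⟨mk h', ext hh'⟩

theorem map_exact {X Y Z : Type u} [AddCommGroup X] [Module S X] [AddCommGroup Y] [Module S Y]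
    [AddCommGroup Z] [Module S Z] {f : X →ₗ[S] Y} {f' : Y →ₗ[S] Z} (h : Function.Exact f f')
    (hs : Function.Surjective f') : Function.Exact (map e f') (map e f) := by
  intro y
  constructor
  · intro hy
    have hker : ∀ a b, f' a = f' b → y a = y b := fun a b hab => by
      obtain ⟨x, hx⟩ := (h (a - b)).1 (by rw [map_sub, hab, sub_self])
      have := DFunLike.congr_fun hy x
      rw [map_apply, hx, map_sub] at this
      exact sub_eq_zero.1 this
    choose s hs using hs
    refine ⟨mk (AddMonoidHom.mk' (fun z => y (s z)) fun a b => ?_), ext fun x => ?_⟩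
    · rw [← map_add]
      exact hker _ _ (by rw [hs, map_add, hs, hs])
    · exact hker _ _ (hs _)
  · rintro ⟨z, rfl⟩
    ext x
    rw [map_apply, map_apply, h.apply_apply_eq_zero, map_zero]
    rfl

variable (e) in
/-- The character module of a projective module is injective. -/
theorem injective_of_projective [Module.Projective S X] : Module.Injective R (CharDual e X) where
  out M M' _ _ _ _ f hf h := by
    let e' : S ≃+* Rᵐᵒᵖ := (RingEquiv.opOp S).trans e.symm.op
    have he' : ∀ r, (e' (e r).unop).unop = r := fun r => by simp [e']
    have he : ∀ s, (e (e' s).unop).unop = s := fun s => by simp [e']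
    -- A map `M → Hom(X, ℚ/ℤ)` is the same as a map `X → Hom(M, ℚ/ℤ)`. Extending the former along
    -- `f` means lifting the latter along the dual of `f`, which is onto as `ℚ/ℤ` is injective.
    let hflip : X →ₗ[S] CharDual e' M :=
      { toFun := fun x => mk (AddMonoidHom.mk' (fun m => h m x) fun a b => by rw [map_add]; rfl)
        map_add' := fun x y => ext fun m => map_add (h m) x y
        map_smul' := fun s x => ext fun m => by
          change h m (s • x) = h ((e' s).unop • m) x
          rw [h.map_smul, smul_apply, he] }
    obtain ⟨k, hk⟩ := Module.projective_lifting_property (map e' f) hflip (map_surjective hf)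
    refine ⟨{ toFun := fun m => mk (AddMonoidHom.mk' (fun x => k x m) fun a b => by
                rw [map_add]; rfl)
              map_add' := fun a b => ext fun x => map_add (k x) a b
              map_smul' := fun r m => ext fun x => by
                change k x (r • m) = k ((e r).unop • x) m
                rw [k.map_smul, smul_apply, he'] }, fun m => ext fun x => ?_⟩
    exact DFunLike.congr_fun (LinearMap.congr_fun hk x) m

variable (e) in
/-- The injective dimension of the character module is at most the projective dimension. -/
theorem hasInjectiveDimensionLT (n : ℕ) (X : Type u) [AddCommGroup X] [Module S X]
    (hX : HasProjectiveDimensionLT (ModuleCat.of S X) (n + 1)) :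
    HasInjectiveDimensionLT (ModuleCat.of R (CharDual e X)) (n + 1) := by
  induction n generalizing X with
  | zero =>
    have := (IsProjective.iff_projective (R := S) X).2
      (projective_iff_hasProjectiveDimensionLT_one.2 hX)
    have := injective_of_projective e (X := X)
    rw [Module.injective_iff_injective_object] at this
    exact inferInstanceAs (HasInjectiveDimensionLT _ 1)
  | succ n ih =>
    let f : (X →₀ S) →ₗ[S] X := Finsupp.linearCombination S id
    have hf : Function.Surjective f := fun x => ⟨Finsupp.single x 1, by simp [f]⟩
    have hS := LinearMap.shortExact_shortComplexKer hf
    have h1 := ih _ (hS.hasProjectiveDimensionLT_X₁ (n + 1)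
      (inferInstanceAs (HasProjectiveDimensionLT (ModuleCat.of S (X →₀ S)) (n + 1))) hX)
    have hex := map_exact (e := e) (X := LinearMap.ker f) (f := (LinearMap.ker f).subtype)
      (LinearMap.exact_subtype_ker_map f) hf
    have hT := ModuleCat.shortComplex_shortExact
      (ModuleCat.shortComplexOfCompEqZero _ _ hex.linearMap_comp_eq_zero) hex
      (map_injective hf) (map_surjective (LinearMap.ker f).injective_subtype)
    have hI := injective_of_projective e (X := X →₀ S)
    rw [Module.injective_iff_injective_object] at hI
    exact hT.hasInjectiveDimensionLT_X₁ (n + 1) h1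
      (inferInstanceAs (HasInjectiveDimensionLT (ModuleCat.of R (CharDual e (X →₀ S))) (n + 1 + 1)))

/-- If every map from `L` to the character module of `S / S_{>0}` extends to `M ⊇ L`, then
`R_{>0} M ∩ L = R_{>0} L`. -/
theorem mem_pos_smul_of_extends (g : NatGrading R) {x₀ : X} (hgen : ∀ x : X, ∃ s : S, s • x₀ = x)
    (hann : ∀ r ∈ g.pos, ∀ x : X, (e r).unop • x = 0)
    (hx₀ : ∀ s : S, s • x₀ = 0 → e.symm (MulOpposite.op s) ∈ g.pos)
    {M : Type*} [AddCommGroup M] [Module R M] (L : Submodule R M)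
    (hL : ∀ h : L →ₗ[R] CharDual e X, ∃ h' : M →ₗ[R] CharDual e X, ∀ l : L, h' l = h l)
    {z : M} (hz : z ∈ L) (hz' : z ∈ g.pos • (⊤ : Submodule R M)) : z ∈ g.pos • L := by
  by_contra hcon
  -- If `z` were not in `R_{>0} L`, a character `χ` of `L / R_{>0} L` would be nonzero on `z`. It is
  -- turned into `h : L → Hom(X, ℚ/ℤ)`, `h(l)(s x₀) = χ(s l)`, which is well defined because the
  -- annihilator of `x₀` has positive degree.
  let T : Submodule R L := (g.pos • L).comap L.subtype
  have hT : ∀ r ∈ g.pos, ∀ l : L, r • l ∈ T := fun r hr l =>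
    Submodule.smul_mem_smul hr l.2
  have hne : T.mkQ ⟨z, hz⟩ ≠ 0 := fun h => hcon ((Submodule.Quotient.mk_eq_zero T).1 h)
  obtain ⟨χ, hχ⟩ := CharacterModule.exists_character_apply_ne_zero_of_ne_zero hne
  choose σ hσ using hgen
  let v : X → L → AddCircle (1 : ℚ) := fun x l => χ (T.mkQ (e.symm (MulOpposite.op (σ x)) • l))
  have hv : ∀ s l, v (s • x₀) l = χ (T.mkQ (e.symm (MulOpposite.op s) • l)) := fun s l => by
    have h1 := hx₀ (σ (s • x₀) - s) (by rw [sub_smul, hσ, sub_self])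
    have h2 := (Submodule.Quotient.mk_eq_zero T).2 (hT _ h1 l)
    rw [MulOpposite.op_sub, map_sub, sub_smul] at h2
    have h3 := sub_eq_zero.1 ((map_sub T.mkQ _ _).symm.trans h2)
    exact congrArg χ h3
  have hvx : ∀ x l, v x l = χ (T.mkQ (e.symm (MulOpposite.op (σ x)) • l)) := fun _ _ => rfl
  let h : L →ₗ[R] CharDual e X :=
    { toFun := fun l => mk (AddMonoidHom.mk' (fun x => v x l) fun x y => by
        conv_lhs => rw [← hσ x, ← hσ y, ← add_smul, hv]
        rw [MulOpposite.op_add, map_add, add_smul, map_add, map_add])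
      map_add' := fun l l' => ext fun x => by
        change v x (l + l') = v x l + v x l'
        rw [hvx, smul_add, map_add, map_add]
      map_smul' := fun r l => ext fun x => by
        change v x (r • l) = v ((e r).unop • x) l
        conv_rhs => rw [← hσ x, smul_smul, hv]
        rw [hvx, smul_smul, MulOpposite.op_mul, map_mul, MulOpposite.op_unop,
          RingEquiv.symm_apply_apply] }
  obtain ⟨h', hh'⟩ := hL h
  -- `R_{>0}` annihilates the character module of `X`, so any map from `M` to it kills `R_{>0} M`,
  -- while `h(z)(x₀) = χ(z)` is nonzero.
  have h0 : h' z = 0 := by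
    refine Submodule.smul_induction_on hz' (fun r hr m _ => ?_) fun x y hx hy => ?_
    · ext x
      rw [h'.map_smul, smul_apply, hann r hr, map_zero]
      rfl
    · rw [map_add, hx, hy, add_zero]
  apply hχ
  have h1 : v ((1 : S) • x₀) ⟨z, hz⟩ = 0 := by
    rw [one_smul]
    change h ⟨z, hz⟩ x₀ = 0
    rw [← hh', h0]
    rfl
  rw [hv, MulOpposite.op_one, map_one, one_smul] at h1
  exact h1

end CharDual

end CharDual

end KoszulDual

end

/-! ### Lifting homological vanishing from leading forms to filtered modules. -/

noncomputable section

namespace KoszulDual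

universe u

open CategoryTheory

section Free

namespace NatGrading

variable {R : Type u} [Ring R] (g : NatGrading R) {ι : Type u} (d : ι → ℕ)

/-- Generators of a submodule `Y` of a graded free module: all pairs of a natural number `j` and
an element of `Y` of degree at most `j`. -/
def FilGen (Y : Submodule R (ι →₀ R)) : Type u := Σ j : ℕ, {y : ι →₀ R // y ∈ Y ∧ y ∈ g.fil d j}

namespace FilGen

variable (Y : Submodule R (ι →₀ R))

/-- The degree of a generator. -/
def deg (s : g.FilGen d Y) : ℕ := s.1

/-- The covering `F' → Y ⊆ F` by the free module on the generators. -/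
def cover : (g.FilGen d Y →₀ R) →ₗ[R] (ι →₀ R) := Finsupp.linearCombination R fun s => s.2.1

/-- The associated graded map `F' → lt Y ⊆ F`. -/
def gradedCover : (g.FilGen d Y →₀ R) →ₗ[R] (ι →₀ R) :=
  Finsupp.linearCombination R fun s => g.top d s.1 s.2.1

variable {Y}

theorem cover_single (s : g.FilGen d Y) (a : R) :
    cover g d Y (Finsupp.single s a) = a • s.2.1 := by simp [cover]

theorem gradedCover_single (s : g.FilGen d Y) (a : R) :
    gradedCover g d Y (Finsupp.single s a) = a • g.top d s.1 s.2.1 := by simp [gradedCover]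

theorem top_single (j : ℕ) (s : g.FilGen d Y) (a : R) : g.top (deg g d Y) j (Finsupp.single s a) =
    if s.1 ≤ j then Finsupp.single s (g.proj (j - s.1) a) else 0 := by
  ext t
  classical
  rw [top_apply]
  by_cases hst : s = t
  · subst hst
    simp only [Finsupp.single_eq_same, deg]
    split_ifs <;> simp
  · rw [Finsupp.single_eq_of_ne' hst, map_zero, ite_self]
    split_ifs
    · rw [Finsupp.single_eq_of_ne' hst]
    · rfl

theorem top_gradedCover (j : ℕ) (x : g.FilGen d Y →₀ R) :
    g.top d j (gradedCover g d Y x) = gradedCover g d Y (g.top (deg g d Y) j x) := by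
  induction x using Finsupp.induction_linear with
  | zero => simp
  | add x y hx hy => simp only [map_add, hx, hy]
  | single s a =>
    rw [gradedCover_single, top_smul_top, top_single]
    split_ifs
    · rw [gradedCover_single]
    · rw [map_zero]

/-- The covering respects the filtration, not the grading: a homogeneous element may have an image
with lower terms, and only its part of degree `j` is given by the graded covering. That part may be
zero. -/
theorem cover_top (j : ℕ) (x : g.FilGen d Y →₀ R) :
    cover g d Y (g.top (deg g d Y) j x) ∈ g.fil d j ∧
      g.top d j (cover g d Y (g.top (deg g d Y) j x)) =
        gradedCover g d Y (g.top (deg g d Y) j x) := by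
  induction x using Finsupp.induction_linear with
  | zero => simp
  | add x y hx hy =>
    simp only [map_add]
    exact ⟨add_mem hx.1 hy.1, by rw [hx.2, hy.2]⟩
  | single s a =>
    rw [top_single]
    split_ifs with h
    · rw [cover_single, gradedCover_single]
      have hp : g.proj (j - s.1) (g.proj (j - s.1) a) = g.proj (j - s.1) a := by
        rw [g.proj_proj, if_pos rfl]
      have h1 := g.smul_mem_fil d hp s.2.2.2
      have h2 := g.top_smul_of_eq d hp s.1 s.2.1
      rw [Nat.sub_add_cancel h] at h1 h2
      exact ⟨h1, h2⟩
    · simp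

theorem top_cover_of_mem_fil {j : ℕ} {x : g.FilGen d Y →₀ R} (hx : x ∈ g.fil (deg g d Y) j) :
    g.top d j (cover g d Y x) = gradedCover g d Y (g.top (deg g d Y) j x) := by
  have hsum := g.sum_top (deg g d Y) (N := j + 1) fun i hi => hx i hi
  conv_lhs => rw [← hsum]
  rw [map_sum, map_sum, Finset.sum_range_succ, (cover_top g d j x).2, Finset.sum_eq_zero, zero_add]
  intro i hi
  exact (cover_top g d i x).1 j (by simpa using hi)

theorem range_cover : LinearMap.range (cover g d Y) = Y := by
  apply le_antisymm
  · rw [cover, Finsupp.range_linearCombination, Submodule.span_le]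
    rintro _ ⟨s, rfl⟩
    exact s.2.2.1
  · intro y hy
    obtain ⟨j, hj⟩ := g.exists_mem_fil d y
    let s : g.FilGen d Y := ⟨j, y, hy, hj⟩
    exact ⟨Finsupp.single s 1, by rw [cover_single, one_smul]⟩

theorem range_gradedCover : LinearMap.range (gradedCover g d Y) = g.lt d Y := by
  rw [gradedCover, Finsupp.range_linearCombination, lt]
  congr 1
  ext z
  constructor
  · rintro ⟨s, rfl⟩
    exact ⟨s.1, s.2.1, s.2.2.1, s.2.2.2, rfl⟩
  · rintro ⟨j, y, hy, hj, rfl⟩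
    exact ⟨⟨j, y, hy, hj⟩, rfl⟩

/-- Every syzygy of leading forms is the leading form of a syzygy. If a homogeneous `x` of degree `j
+ 1` is killed by the graded covering, its image under `cover` is an element of `Y` of degree at
most `j`, and hence itself one of the generators. Subtracting that generator from `x` gives an
element of the kernel with leading form `x`. This is the reason for taking all elements of `Y` as
generators, each in every admissible degree. -/
theorem ker_gradedCover :
    LinearMap.ker (gradedCover g d Y) = g.lt (deg g d Y) (LinearMap.ker (cover g d Y)) := by
  apply le_antisymm
  · intro x hx
    refine g.mem_of_top_mem (deg g d Y) _ fun j => ?_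
    have hx0 : gradedCover g d Y (g.top (deg g d Y) j x) = 0 := by
      rw [← top_gradedCover, LinearMap.mem_ker.1 hx, map_zero]
    obtain ⟨h1, h2⟩ := cover_top g d j x
    rw [hx0] at h2
    have htt : g.top (deg g d Y) j (g.top (deg g d Y) j x) = g.top (deg g d Y) j x := by
      rw [top_top, if_pos rfl]
    rcases j with _ | j
    · have h3 := g.eq_zero_of_mem_fil_zero d h1 h2
      rw [← htt]
      exact g.top_mem_lt _ (LinearMap.mem_ker.2 h3) (g.top_mem_fil _ _ _)
    · have h3 := g.mem_fil_of_top_eq_zero d h1 h2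
      have hY : cover g d Y (g.top (deg g d Y) (j + 1) x) ∈ Y :=
        (range_cover g d).le (LinearMap.mem_range_self _ _)
      let s : g.FilGen d Y := ⟨j, _, hY, h3⟩
      have hs : ∀ m, j < m → g.top (deg g d Y) m (Finsupp.single s 1) = 0 := fun m hm => by
        rw [top_single, if_pos hm.le, g.proj_of_eq g.proj_zero_one, if_neg (by
          simp only [s]; omega), Finsupp.single_zero]
      have key : g.top (deg g d Y) (j + 1) (g.top (deg g d Y) (j + 1) x - Finsupp.single s 1) =
          g.top (deg g d Y) (j + 1) x := by
        rw [map_sub, htt, hs _ (Nat.lt_succ_self j), sub_zero]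
      rw [← key]
      refine g.top_mem_lt _ (LinearMap.mem_ker.2 ?_) (sub_mem (g.top_mem_fil _ _ _) fun m hm =>
        hs m (by omega))
      rw [map_sub, cover_single, one_smul, sub_self]
  · rw [lt, Submodule.span_le]
    rintro _ ⟨j, y, hy, hj, rfl⟩
    rw [SetLike.mem_coe, LinearMap.mem_ker, ← top_cover_of_mem_fil g d hj, LinearMap.mem_ker.1 hy,
      map_zero]

end FilGen

end NatGrading

end Free

/-- A short exact sequence `0 → F' / ker f → F → F / range f → 0`. -/
theorem shortExact_quotient {R : Type u} [Ring R] {F' F : Type u} [AddCommGroup F'] [Module R F']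
    [AddCommGroup F] [Module R F] (f : F' →ₗ[R] F) {N' : Submodule R F'} {N : Submodule R F}
    (hN' : LinearMap.ker f = N') (hN : LinearMap.range f = N) :
    ∃ (h : N.mkQ ∘ₗ N'.liftQ f hN'.ge = 0),
      (ModuleCat.shortComplexOfCompEqZero (N'.liftQ f hN'.ge) N.mkQ h).ShortExact := by
  subst hN' hN
  have hex : Function.Exact ((LinearMap.ker f).liftQ f le_rfl) (LinearMap.range f).mkQ := by
    rw [LinearMap.exact_iff, Submodule.ker_mkQ, Submodule.range_liftQ]
  exact ⟨hex.linearMap_comp_eq_zero, ModuleCat.shortComplex_shortExact _ hex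
    (LinearMap.ker_eq_bot.1 (Submodule.ker_liftQ_eq_bot _ _ _ le_rfl))
    (Submodule.mkQ_surjective _)⟩

/-- The obstruction to extending `f` is its image under the connecting map to `Ext¹(F / L, J)`. -/
theorem exists_extension_of_subsingleton_ext {R : Type u} [Ring R] {F J : Type u} [AddCommGroup F]
    [Module R F] [AddCommGroup J] [Module R J] (L : Submodule R F)
    (h : Subsingleton (Abelian.Ext (ModuleCat.of R (F ⧸ L)) (ModuleCat.of R J) 1))
    (f : L →ₗ[R] J) : ∃ f' : F →ₗ[R] J, ∀ l : L, f' l = f l := by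
  have hex : Function.Exact L.subtype L.mkQ := by
    rw [LinearMap.exact_iff, Submodule.ker_mkQ, Submodule.range_subtype]
  have hS := ModuleCat.shortComplex_shortExact
      (ModuleCat.shortComplexOfCompEqZero _ _ hex.linearMap_comp_eq_zero) hex
      L.injective_subtype L.mkQ_surjective
  obtain ⟨x, hx⟩ := Abelian.Ext.contravariant_sequence_exact₁ hS (Y := ModuleCat.of R J)
    (Abelian.Ext.mk₀ (ModuleCat.ofHom f)) (add_zero 1) (h.elim _ _)
  obtain ⟨φ, rfl⟩ := Abelian.Ext.homEquiv₀.symm.surjective x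
  refine ⟨φ.hom, fun l => ?_⟩
  rw [Abelian.Ext.homEquiv₀_symm_apply, Abelian.Ext.mk₀_comp_mk₀] at hx
  have := Abelian.Ext.homEquiv₀.symm.injective hx
  exact congrArg (fun t => t.hom l) this

namespace NatGrading

variable {R : Type u} [Ring R] (g : NatGrading R) {K : Type*} [Ring K] [IsSemisimpleRing K]
  [Module K R] [IsScalarTower K R R]

/-- Dimension shifting on two parallel sequences: covering `Y` and `lt Y` by the same free module
lowers by one both the `Ext` degree for the leading forms and the projective dimension to be
bounded. At the bottom, vanishing of `Ext¹` makes maps to `J` extend, and by `hJ` the summand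
criterion applies. -/
theorem hasProjectiveDimensionLT_quotient
    (hK : ∀ c : K, g.proj 0 (c • (1 : R)) = c • (1 : R))
    (hK' : ∀ r : R, g.proj 0 r = r → ∃ c : K, c • (1 : R) = r)
    {J : Type u} [AddCommGroup J] [Module R J]
    (hJ : ∀ (ι : Type u) (L : Submodule R (ι →₀ R)),
      (∀ f : L →ₗ[R] J, ∃ f' : (ι →₀ R) →ₗ[R] J, ∀ l : L, f' l = f l) →
      ∀ z ∈ L, z ∈ g.pos • (⊤ : Submodule R (ι →₀ R)) → z ∈ g.pos • L)
    (n : ℕ) (ι : Type u) (d : ι → ℕ) (Y : Submodule R (ι →₀ R))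
    (hext : Subsingleton
      (Abelian.Ext (ModuleCat.of R ((ι →₀ R) ⧸ g.lt d Y)) (ModuleCat.of R J) (n + 1))) :
    HasProjectiveDimensionLT (ModuleCat.of R ((ι →₀ R) ⧸ Y)) (n + 1) := by
  induction n generalizing ι with
  | zero =>
    have := g.projective_quotient_of_lt d hK hK' Y fun x hx hpos =>
      hJ ι _ (exists_extension_of_subsingleton_ext _ hext) x hx (by
        rw [← Finsupp.sum_single x, Finsupp.sum]
        refine Submodule.sum_mem _ fun s _ => ?_
        rw [← mul_one (x s), ← smul_eq_mul, ← Finsupp.smul_single]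
        exact Submodule.smul_mem_smul (hpos s) trivial)
    exact inferInstanceAs (HasProjectiveDimensionLT (ModuleCat.of R ((ι →₀ R) ⧸ Y)) 1)
  | succ n ih =>
    obtain ⟨h, hS⟩ := shortExact_quotient (FilGen.cover g d Y) rfl (FilGen.range_cover g d)
    obtain ⟨h', hS'⟩ := shortExact_quotient (FilGen.gradedCover g d Y)
      (FilGen.ker_gradedCover g d) (FilGen.range_gradedCover g d)
    refine hS.hasProjectiveDimensionLT_X₃ (n + 1) (ih _ (FilGen.deg g d Y) _ ⟨fun x y => ?_⟩)
      (inferInstanceAs (HasProjectiveDimensionLT (ModuleCat.of R (ι →₀ R)) (n + 1 + 1)))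
    -- The module on the left is `lt Y` up to isomorphism; its `Ext` of degree `n + 1` embeds into
    -- that of `F / lt Y` of degree `n + 2`, as `F` is free.
    have key : ∀ x : Abelian.Ext (ModuleCat.of R ((g.FilGen d Y →₀ R) ⧸
        g.lt (FilGen.deg g d Y) (LinearMap.ker (FilGen.cover g d Y)))) (ModuleCat.of R J) (n + 1),
        x = 0 := fun x => by
      obtain ⟨x₂, rfl⟩ := Abelian.Ext.contravariant_sequence_exact₁ hS' (Y := ModuleCat.of R J) x
        (add_comm 1 (n + 1)) (hext.elim _ _)
      have : x₂ = 0 := Abelian.Ext.eq_zero_of_hasProjectiveDimensionLT x₂ 1 (by omega)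
      rw [this, Abelian.Ext.comp_zero]
    rw [key x, key y]

/-- Let `R` be a graded ring whose degree zero component is semisimple. If the left module
`X = S / S_{>0}` over the opposite ring `S` has projective dimension at most `n`, then all left
`R`-modules have projective dimension at most `n`. -/
theorem hasProjectiveDimensionLT_of_opposite
    (hK : ∀ c : K, g.proj 0 (c • (1 : R)) = c • (1 : R))
    (hK' : ∀ r : R, g.proj 0 r = r → ∃ c : K, c • (1 : R) = r)
    {S : Type u} [Ring S] (e : R ≃+* Sᵐᵒᵖ) {X : Type u} [AddCommGroup X] [Module S X]
    {x₀ : X} (hgen : ∀ x : X, ∃ s : S, s • x₀ = x)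
    (hann : ∀ r ∈ g.pos, ∀ x : X, (e r).unop • x = 0)
    (hx₀ : ∀ s : S, s • x₀ = 0 → e.symm (MulOpposite.op s) ∈ g.pos)
    (n : ℕ) (hX : HasProjectiveDimensionLT (ModuleCat.of S X) (n + 1))
    (M : Type u) [AddCommGroup M] [Module R M] :
    HasProjectiveDimensionLT (ModuleCat.of R M) (n + 1) := by
  let f : (M →₀ R) →ₗ[R] M := Finsupp.linearCombination R id
  have hf : Function.Surjective f := fun x => ⟨Finsupp.single x 1, by simp [f]⟩
  have hJ := CharDual.hasInjectiveDimensionLT e n X hX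
  -- `M` is any module: the generators of its free cover are put in degree zero, and the kernel need
  -- not be homogeneous.
  have := g.hasProjectiveDimensionLT_quotient hK hK' (J := CharDual e X)
    (fun ι L hL z hz hz' => CharDual.mem_pos_smul_of_extends g hgen hann hx₀ L hL hz hz')
    n M (fun _ => 0) (LinearMap.ker f) (hJ.subsingleton _ _ _ le_rfl _)
  exact hasProjectiveDimensionLT_of_iso (f.quotKerEquivOfSurjective hf).toModuleIso _

end NatGrading

end KoszulDual

end

/-! ### Minimality of linear resolutions and the projective dimension of `A / A_{>0}`. -/

noncomputable section

namespace KoszulDual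

universe u

open CategoryTheory

section GradedModule

variable {M : Type*} [AddCommGroup M] {D : ℕ → AddSubgroup M} (hD : DirectSum.IsInternal D)

/-- The projection of a graded abelian group onto its degree `n` component. -/
def homComponent (n : ℕ) : M →+ M :=
  (D n).subtype.comp ((DFinsupp.evalAddMonoidHom n).comp
    (AddEquiv.ofBijective (DirectSum.coeAddMonoidHom D) hD).symm.toAddMonoidHom)

theorem homComponent_mem (n : ℕ) (x : M) : homComponent hD n x ∈ D n :=
  ((AddEquiv.ofBijective (DirectSum.coeAddMonoidHom D) hD).symm x n).2

theorem homComponent_of_mem {m : ℕ} {x : M} (hx : x ∈ D m) (n : ℕ) :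
    homComponent hD n x = if m = n then x else 0 := by
  have : (AddEquiv.ofBijective (DirectSum.coeAddMonoidHom D) hD).symm x =
      DirectSum.of (fun i => D i) m ⟨x, hx⟩ := by
    rw [AddEquiv.symm_apply_eq]
    exact (DirectSum.coeAddMonoidHom_of D m ⟨x, hx⟩).symm
  change (((AddEquiv.ofBijective (DirectSum.coeAddMonoidHom D) hD).symm x) n : M) = _
  rw [this]
  by_cases h : m = n
  · subst h
    rw [if_pos rfl, DirectSum.of_eq_same]
  · rw [if_neg h, DirectSum.of_eq_of_ne _ _ _ (Ne.symm h)]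
    rfl

include hD in
theorem graded_induction {p : M → Prop} (h0 : p 0) (hadd : ∀ x y, p x → p y → p (x + y))
    (hp : ∀ n, ∀ x ∈ D n, p x) (x : M) : p x := by
  obtain ⟨y, rfl⟩ := hD.2 x
  induction y using DirectSum.induction_on with
  | zero => rwa [map_zero]
  | of i y =>
    rw [DirectSum.coeAddMonoidHom_of]
    exact hp i _ y.2
  | add x y hx hy =>
    rw [map_add]
    exact hadd _ _ hx hy

theorem homComponent_map {N : Type*} [AddCommGroup N] {D' : ℕ → AddSubgroup N}
    (hD' : DirectSum.IsInternal D') (f : M →+ N) (hf : ∀ n, ∀ x ∈ D n, f x ∈ D' n) (n : ℕ) (x : M) :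
    homComponent hD' n (f x) = f (homComponent hD n x) := by
  refine graded_induction (p := fun x => homComponent hD' n (f x) = f (homComponent hD n x)) hD
    ?_ (fun x y hx hy => ?_) (fun m x hx => ?_) x
  · simp only [map_zero]
  · simp only [map_add, hx, hy]
  rw [homComponent_of_mem hD hx, homComponent_of_mem hD' (hf m x hx)]
  split_ifs
  · rfl
  · rw [map_zero]

variable {𝕜 A : Type*} [Field 𝕜] [Ring A] [Algebra 𝕜 A] {𝒜 : ℕ → Submodule 𝕜 A}
  [Module A M]
  (hs : ∀ m n (a : A) (x : M), a ∈ 𝒜 m → x ∈ D n → a • x ∈ D (m + n))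

include hs in
theorem homComponent_smul {m : ℕ} {a : A} (ha : a ∈ 𝒜 m) (n : ℕ) (x : M) :
    homComponent hD (m + n) (a • x) = a • homComponent hD n x := by
  refine graded_induction
    (p := fun x => homComponent hD (m + n) (a • x) = a • homComponent hD n x) hD
    ?_ (fun x y hx hy => ?_) (fun l x hx => ?_) x
  · simp only [smul_zero, map_zero]
  · simp only [map_add, smul_add, hx, hy]
  rw [homComponent_of_mem hD hx, homComponent_of_mem hD (hs _ _ _ _ ha hx)]
  by_cases h : l = n
  · rw [if_pos h, if_pos (by omega)]
  · rw [if_neg h, if_neg (by omega), smul_zero]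

variable [GradedAlgebra 𝒜]

include hs in
theorem homComponent_smul_of_mem {i : ℕ} {v : M} (hv : v ∈ D i) (a : A) (n : ℕ) :
    homComponent hD n (a • v) = if i ≤ n then GradedRing.proj 𝒜 (n - i) a • v else 0 := by
  refine DirectSum.Decomposition.inductionOn 𝒜
    (motive := fun a => homComponent hD n (a • v) =
      if i ≤ n then GradedRing.proj 𝒜 (n - i) a • v else 0) (by simp) ?_ ?_ a
  · intro m a
    rw [homComponent_of_mem hD (hs _ _ _ _ a.2 hv), GradedRing.proj_apply]
    by_cases h : m + i = n
    · rw [if_pos h, if_pos (by omega), show n - i = m by omega, DirectSum.decompose_of_mem_same _ a.2]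
    · rw [if_neg h]
      split_ifs with h'
      · rw [DirectSum.decompose_of_mem_ne _ a.2 (by omega), zero_smul]
      · rfl
  · intro a b ha hb
    rw [add_smul, map_add, ha, hb]
    split_ifs <;> simp [add_smul]

variable {i : ℕ} (hgen : Submodule.span A (D i : Set M) = ⊤)

include hs hgen in
theorem homComponent_mem_closure (n : ℕ) (x : M) : homComponent hD n x ∈
    AddSubgroup.closure {y | i ≤ n ∧ ∃ a ∈ 𝒜 (n - i), ∃ v ∈ D i, a • v = y} := by
  have hx : x ∈ Submodule.span A (D i : Set M) := hgen ▸ Submodule.mem_top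
  induction hx using Submodule.span_induction with
  | zero => rw [map_zero]; exact AddSubgroup.zero_mem _
  | add x y _ _ hx hy => rw [map_add]; exact add_mem hx hy
  | mem x hx =>
    rw [homComponent_of_mem hD hx]
    split_ifs with h
    · subst h
      exact AddSubgroup.subset_closure ⟨le_rfl, 1, by
        rw [Nat.sub_self]; exact SetLike.GradedOne.one_mem, x, hx, one_smul _ _⟩
    · exact AddSubgroup.zero_mem _
  | smul b x hx' hx =>
    -- The hypothesis on `x` says nothing about `b • x` for inhomogeneous `b`; the span is unfolded
    -- a second time with arbitrary `b`.
    clear hx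
    induction hx' using Submodule.span_induction generalizing b with
    | zero => rw [smul_zero, map_zero]; exact AddSubgroup.zero_mem _
    | add x y _ _ hx hy => rw [smul_add, map_add]; exact add_mem (hx b) (hy b)
    | mem x hx =>
      rw [homComponent_smul_of_mem hD hs hx]
      split_ifs with h
      · exact AddSubgroup.subset_closure ⟨h, _, SetLike.coe_mem _, x, hx, rfl⟩
      · exact AddSubgroup.zero_mem _
    | smul c x _ hx => rw [smul_smul]; exact hx _

include hD hs hgen in
theorem mem_closure_of_mem {n : ℕ} {x : M} (hx : x ∈ D n) : x ∈
    AddSubgroup.closure {y | i ≤ n ∧ ∃ a ∈ 𝒜 (n - i), ∃ v ∈ D i, a • v = y} := by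
  have := homComponent_mem_closure hD hs hgen n x
  rwa [homComponent_of_mem hD hx, if_pos rfl] at this

include hs hgen in
theorem homComponent_eq_zero_of_lt {n : ℕ} (h : n < i) (x : M) : homComponent hD n x = 0 := by
  have := homComponent_mem_closure hD hs hgen n x
  rw [show {y | i ≤ n ∧ ∃ a ∈ 𝒜 (n - i), ∃ v ∈ D i, a • v = y} = ∅ from
    Set.eq_empty_of_forall_notMem fun y hy => absurd hy.1 (by omega),
    AddSubgroup.closure_empty, AddSubgroup.mem_bot] at this
  exact this

end GradedModule

namespace LinearResolution

variable {𝕜 : Type*} {A : Type u} [Field 𝕜] [Ring A] [Algebra 𝕜 A]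
  {𝒜 : ℕ → Submodule 𝕜 A} [GradedAlgebra 𝒜] (L : LinearResolution 𝒜)

instance (i : ℕ) : AddCommGroup (L.P i) := L.addCommGroup i

instance (i : ℕ) : Module A (L.P i) := L.module i

instance (i : ℕ) : Module.Projective A (L.P i) := L.projective i

/-- The projection onto the degree `n` component of `P i`. -/
def comp (i n : ℕ) : L.P i →+ L.P i := homComponent (L.isInternal i) n

theorem comp_mem (i n : ℕ) (x : L.P i) : L.comp i n x ∈ L.deg i n := homComponent_mem _ _ _

theorem comp_of_mem {i n : ℕ} {x : L.P i} (hx : x ∈ L.deg i n) : L.comp i n x = x := by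
  rw [comp, homComponent_of_mem _ hx, if_pos rfl]

theorem comp_of_lt {i n : ℕ} (h : n < i) (x : L.P i) : L.comp i n x = 0 :=
  homComponent_eq_zero_of_lt _ (L.smul_mem i) (L.generated i) h x

theorem comp_d (i n : ℕ) (x : L.P (i + 1)) : L.comp i n (L.d i x) = L.d i (L.comp (i + 1) n x) :=
  homComponent_map _ _ (L.d i).toAddMonoidHom (fun n x hx => L.d_mem i n x hx) n x

theorem comp_smul (i : ℕ) {m : ℕ} {a : A} (ha : a ∈ 𝒜 m) (n : ℕ) (x : L.P i) :
    L.comp i (m + n) (a • x) = a • L.comp i n x :=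
  homComponent_smul _ (L.smul_mem i) ha n x

/-- The differential is injective on generators. -/
theorem eq_zero_of_d_eq_zero {i : ℕ} {v : L.P (i + 1)} (hv : v ∈ L.deg (i + 1) (i + 1))
    (h : L.d i v = 0) : v = 0 := by
  obtain ⟨y, rfl⟩ := (L.exact_succ i v).1 h
  rw [← L.comp_of_mem hv, comp_d, L.comp_of_lt (Nat.lt_succ_self _), map_zero]

theorem eq_zero_of_deg_eq_zero {i : ℕ} (h : ∀ v ∈ L.deg i i, v = 0) (x : L.P i) : x = 0 := by
  have : x ∈ Submodule.span A (L.deg i i : Set (L.P i)) := L.generated i ▸ Submodule.mem_top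
  rw [Submodule.span_eq_bot.2 h] at this
  exact (Submodule.mem_bot A).1 this

theorem exists_preimage_of_d_eq_zero {i : ℕ} {n : ℕ} {x : L.P (i + 1)} (hx : x ∈ L.deg (i + 1) n)
    (h : L.d i x = 0) : ∃ y ∈ L.deg (i + 1 + 1) n, L.d (i + 1) y = x := by
  obtain ⟨y, rfl⟩ := (L.exact_succ i x).1 h
  exact ⟨_, L.comp_mem _ n y, by rw [← comp_d, L.comp_of_mem hx]⟩

theorem exists_preimage_of_ε_eq_zero {n : ℕ} {x : L.P 0} (hx : x ∈ L.deg 0 n)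
    (h : L.ε x = 0) : ∃ y ∈ L.deg 1 n, L.d 0 y = x := by
  obtain ⟨y, rfl⟩ := (L.exact_zero x).1 h
  exact ⟨_, L.comp_mem _ n y, by rw [← comp_d, L.comp_of_mem hx]⟩

/-- If the `i`-th syzygy is projective, then `P (i + 1)` vanishes, and conversely. -/
theorem projective_syzygy_iff {i : ℕ} {Q : Type u} [AddCommGroup Q] [Module A Q]
    (f : L.P i →ₗ[A] Q) (hf : Function.Surjective f) (hex : Function.Exact (L.d i) f) :
    Module.Projective A Q ↔ ∀ v ∈ L.deg (i + 1) (i + 1), v = 0 := by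
  constructor
  · intro hQ v hv
    refine L.eq_zero_of_d_eq_zero hv ?_
    obtain ⟨s, hs⟩ := Module.projective_lifting_property f LinearMap.id hf
    -- The splitting `s` need not be graded. Still, `x - s (f x)` lies in the image of `P (i + 1)`,
    -- which starts in degree `i + 1`.
    have hr : ∀ x, L.comp i i (x - s (f x)) = 0 := fun x => by
      obtain ⟨z, hz⟩ := (hex (x - s (f x))).1 (by
        rw [map_sub, sub_eq_zero]
        exact (LinearMap.congr_fun hs (f x)).symm)
      rw [← hz, comp_d, L.comp_of_lt (Nat.lt_succ_self i), map_zero]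
    have hdv := L.d_mem i _ v hv
    have hfd : f (L.d i v) = 0 := hex.apply_apply_eq_zero v
    -- `d v` has degree `i + 1`, so it is a sum of products of `A₁` with generators of `P i`; on
    -- these the degree `i + 1` part of `x - s (f x)` vanishes by `hr`. Since `f (d v) = 0`, this
    -- gives `d v = 0`.
    suffices H : ∀ x ∈ AddSubgroup.closure
        {y | i ≤ i + 1 ∧ ∃ a ∈ 𝒜 (i + 1 - i), ∃ v ∈ L.deg i i, a • v = y},
        L.comp i (i + 1) (x - s (f x)) = 0 by
      have := H _ (mem_closure_of_mem (L.isInternal i) (L.smul_mem i) (L.generated i) hdv)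
      rwa [hfd, map_zero, sub_zero, L.comp_of_mem hdv] at this
    intro x hx
    induction hx using AddSubgroup.closure_induction with
    | zero => simp
    | add x y _ _ hx hy =>
      rw [map_add, map_add, add_sub_add_comm, map_add, hx, hy, add_zero]
    | neg x _ hx =>
      rw [map_neg, map_neg, neg_sub_neg, ← neg_sub, map_neg, hx, neg_zero]
    | mem x hx =>
      obtain ⟨-, a, ha, v, hv, rfl⟩ := hx
      rw [Nat.add_sub_cancel_left] at ha
      rw [map_smul, map_smul, ← smul_sub, add_comm i 1, L.comp_smul i ha, hr, smul_zero]
  · intro h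
    have hinj : Function.Injective f := by
      rw [injective_iff_map_eq_zero]
      intro x hx
      obtain ⟨y, rfl⟩ := (hex x).1 hx
      rw [L.eq_zero_of_deg_eq_zero h y, map_zero]
    exact Module.Projective.of_equiv (LinearEquiv.ofBijective f ⟨hinj, hf⟩)

/-- Dimension shifting: the range of `d n` inside `P n` is the syzygy number `n + 1`, which accounts
for the shift by `n + 1` between the two bounds. -/
theorem hasProjectiveDimensionLT_iff_syzygy (m n : ℕ) :
    HasProjectiveDimensionLT (ModuleCat.of A (A ⧸ positivePart 𝒜)) (m + n + 2) ↔
      HasProjectiveDimensionLT (ModuleCat.of A (LinearMap.range (L.d n))) (m + 1) := by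
  induction n generalizing m with
  | zero =>
    have hex : Function.Exact (LinearMap.range (L.d 0)).subtype L.ε := by
      rw [LinearMap.exact_iff, Submodule.range_subtype]
      exact L.exact_zero.linearMap_ker_eq
    exact (ModuleCat.shortComplex_shortExact
      (ModuleCat.shortComplexOfCompEqZero _ _ hex.linearMap_comp_eq_zero) hex
      (Submodule.injective_subtype _) L.ε_surjective).hasProjectiveDimensionLT_X₃_iff m
      (inferInstanceAs (Projective (ModuleCat.of A (L.P 0))))
  | succ n ih =>
    have hex : Function.Exact (LinearMap.range (L.d (n + 1))).subtype (L.d n).rangeRestrict := by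
      rw [LinearMap.exact_iff, Submodule.range_subtype, LinearMap.ker_rangeRestrict]
      exact (L.exact_succ n).linearMap_ker_eq
    rw [← (ModuleCat.shortComplex_shortExact
      (ModuleCat.shortComplexOfCompEqZero _ _ hex.linearMap_comp_eq_zero) hex
      (Submodule.injective_subtype _)
      (L.d n).surjective_rangeRestrict).hasProjectiveDimensionLT_X₃_iff m
      (inferInstanceAs (Projective (ModuleCat.of A (L.P (n + 1)))))]
    have := ih (m + 1)
    rwa [show m + 1 + n + 2 = m + (n + 1) + 2 by ring] at this

/-- The projective dimension of `A / A_{>0}` is at most `n` if and only if the term `P (n + 1)` of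
a linear resolution vanishes. -/
theorem hasProjectiveDimensionLT_iff (n : ℕ) :
    HasProjectiveDimensionLT (ModuleCat.of A (A ⧸ positivePart 𝒜)) (n + 1) ↔
      ∀ v ∈ L.deg (n + 1) (n + 1), v = 0 := by
  rcases n with _ | n
  · rw [← L.projective_syzygy_iff L.ε L.ε_surjective L.exact_zero,
      IsProjective.iff_projective, projective_iff_hasProjectiveDimensionLT_one]
  · have h := L.hasProjectiveDimensionLT_iff_syzygy 0 n
    rw [zero_add] at h
    rw [show n + 1 + 1 = n + 2 from rfl, h, ← projective_iff_hasProjectiveDimensionLT_one,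
      ← IsProjective.iff_projective]
    refine L.projective_syzygy_iff (L.d n).rangeRestrict (L.d n).surjective_rangeRestrict ?_
    rw [LinearMap.exact_iff, LinearMap.ker_rangeRestrict]
    exact (L.exact_succ n).linearMap_ker_eq

theorem exists_deg_zero_lift : ∃ v ∈ L.deg 0 0, L.ε v = (positivePart 𝒜).mkQ 1 := by
  obtain ⟨x, hx⟩ := L.ε_surjective ((positivePart 𝒜).mkQ 1)
  refine ⟨_, L.comp_mem 0 0 x, ?_⟩
  rw [← hx]
  refine graded_induction (p := fun x => L.ε (L.comp 0 0 x) = L.ε x) (L.isInternal 0)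
    ?_ (fun x y hx hy => ?_) (fun n x hx => ?_) x
  · simp only [map_zero]
  · simp only [map_add, hx, hy]
  rw [comp, homComponent_of_mem _ hx]
  split_ifs with h
  · rfl
  · obtain ⟨a, ha, hxa⟩ := L.ε_mem n x hx
    rw [hxa, map_zero]
    refine ((Submodule.Quotient.mk_eq_zero _).2 ?_).symm
    change GradedRing.proj 𝒜 0 a = 0
    rw [GradedRing.proj_apply, DirectSum.decompose_of_mem_ne _ ha h]

end LinearResolution

end KoszulDual

end

/-! ### Quadratic rings acting on a graded dual by contraction. -/

noncomputable section

namespace KoszulDual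

section Contraction

variable {𝕜 k F : Type*} [Field 𝕜] [Ring k] [Algebra 𝕜 k] [AddCommGroup F] [Module 𝕜 F]
  {V : ℕ → Type*} [∀ i, AddCommGroup (V i)] [∀ i, Module 𝕜 (V i)]
  [∀ i, Module k (V i)] [∀ i, IsScalarTower 𝕜 k (V i)]

/-- For a bilinear map `γ : F × V → V'` and a linear map `u : F → V`, the linear map
`f ⊗ g ↦ γ(f, u(g))`. -/
def contract {V' V : Type*} [AddCommGroup V'] [Module 𝕜 V'] [AddCommGroup V] [Module 𝕜 V]
    (γ : F →ₗ[𝕜] V →ₗ[𝕜] V') (u : F →ₗ[𝕜] V) : F ⊗[𝕜] F →ₗ[𝕜] V' :=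
  TensorProduct.lift (γ.compl₂ u)

@[simp] theorem contract_tmul {V' V : Type*} [AddCommGroup V'] [Module 𝕜 V'] [AddCommGroup V]
    [Module 𝕜 V] (γ : F →ₗ[𝕜] V →ₗ[𝕜] V') (u : F →ₗ[𝕜] V) (f g : F) :
    contract γ u (f ⊗ₜ g) = γ f (u g) := rfl

variable (γ : ∀ i, F →ₗ[𝕜] V (i + 1) →ₗ[𝕜] V i)

/-- The action of `k ⊕ F` on the product of the `V i`. -/
def generatorAction : k × F →ₗ[𝕜] Module.End 𝕜 (∀ i, V i) :=
  LinearMap.coprod (Algebra.lsmul 𝕜 𝕜 (∀ i, V i)).toLinearMap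
    { toFun := fun f => LinearMap.pi fun i => (γ i f).comp (LinearMap.proj (i + 1))
      map_add' := fun f g => by ext w i : 2; simp
      map_smul' := fun c f => by ext w i : 2; simp }

theorem generatorAction_left (r : k) (w : ∀ i, V i) : generatorAction γ (r, 0) w = r • w := by
  simp only [generatorAction, LinearMap.coprod_apply, map_zero, add_zero]
  rfl

theorem generatorAction_right (f : F) (w : ∀ i, V i) (i : ℕ) :
    generatorAction (k := k) γ (0, f) w i = γ i f (w (i + 1)) := by
  simp [generatorAction]

variable [Module k F] [Module kᵐᵒᵖ F]

theorem TensorRing.ι_smul (a : k) (f : F) :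
    TensorRing.ι 𝕜 k F (a • f) = TensorRing.base 𝕜 k F a * TensorRing.ι 𝕜 k F f :=
  (RingQuot.mkAlgHom_rel 𝕜 (TensorRing.Rel.smul_left (𝕜 := 𝕜) a f)).trans (map_mul _ _ _)

theorem TensorRing.ι_op_smul (a : k) (f : F) :
    TensorRing.ι 𝕜 k F (MulOpposite.op a • f) = TensorRing.ι 𝕜 k F f * TensorRing.base 𝕜 k F a :=
  (RingQuot.mkAlgHom_rel 𝕜 (TensorRing.Rel.smul_right (𝕜 := 𝕜) f a)).trans (map_mul _ _ _)

variable (hl : ∀ i (a : k) f v, γ i (a • f) v = a • γ i f v)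
  (hr : ∀ i (a : k) f v, γ i (MulOpposite.op a • f) v = γ i f (a • v))

/-- The action of the tensor ring on the product of the `V i`. -/
def tensorRingAction : TensorRing 𝕜 k F →ₐ[𝕜] Module.End 𝕜 (∀ i, V i) :=
  RingQuot.liftAlgHom 𝕜 ⟨TensorAlgebra.lift 𝕜 (generatorAction γ), by
    rintro x y (_ | ⟨r, s⟩ | ⟨r, f⟩ | ⟨f, r⟩)
    · ext w : 1
      rw [TensorAlgebra.lift_ι_apply, map_one, generatorAction_left, one_smul]
      rfl
    · ext w : 1
      rw [map_mul, TensorAlgebra.lift_ι_apply, TensorAlgebra.lift_ι_apply,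
        TensorAlgebra.lift_ι_apply, Module.End.mul_apply, generatorAction_left,
        generatorAction_left, generatorAction_left, mul_smul]
    · ext w i : 2
      rw [map_mul, TensorAlgebra.lift_ι_apply, TensorAlgebra.lift_ι_apply,
        TensorAlgebra.lift_ι_apply, Module.End.mul_apply, generatorAction_left, Pi.smul_apply,
        generatorAction_right, generatorAction_right, hl]
    · ext w i : 2
      rw [map_mul, TensorAlgebra.lift_ι_apply, TensorAlgebra.lift_ι_apply,
        TensorAlgebra.lift_ι_apply, Module.End.mul_apply, generatorAction_left,
        generatorAction_right, generatorAction_right, hr, Pi.smul_apply]⟩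

theorem tensorRingAction_base (r : k) (w : ∀ i, V i) :
    tensorRingAction γ hl hr (TensorRing.base 𝕜 k F r) w = r • w := by
  rw [← generatorAction_left γ, ← TensorAlgebra.lift_ι_apply (generatorAction γ)]
  exact congrArg (fun t : Module.End 𝕜 (∀ i, V i) => t w)
    (RingQuot.liftAlgHom_mkAlgHom_apply 𝕜 _ _ _)

theorem tensorRingAction_ι (f : F) (w : ∀ i, V i) (i : ℕ) :
    tensorRingAction γ hl hr (TensorRing.ι 𝕜 k F f) w i = γ i f (w (i + 1)) := by
  rw [← generatorAction_right (k := k) γ, ← TensorAlgebra.lift_ι_apply (generatorAction γ)]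
  exact congrArg (fun t : Module.End 𝕜 (∀ i, V i) => t w i)
    (RingQuot.liftAlgHom_mkAlgHom_apply 𝕜 _ _ _)

theorem tensorRingAction_ι₂ (τ : F ⊗[𝕜] F) (w : ∀ i, V i) (i : ℕ) :
    tensorRingAction γ hl hr (TensorRing.ι₂ 𝕜 k F τ) w i =
      contract (γ i) ((γ (i + 1)).flip (w (i + 2))) τ := by
  induction τ with
  | zero => simp
  | add x y hx hy => simp only [map_add, LinearMap.add_apply, Pi.add_apply, hx, hy]
  | tmul f g =>
    change tensorRingAction γ hl hr (TensorRing.ι 𝕜 k F f * TensorRing.ι 𝕜 k F g) w i = _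
    rw [map_mul, Module.End.mul_apply, tensorRingAction_ι, tensorRingAction_ι, contract_tmul]
    rfl

variable {Q : Submodule 𝕜 (F ⊗[𝕜] F)}
  (hQ : ∀ i (v : V (i + 2)), ∀ τ ∈ Q, contract (γ i) ((γ (i + 1)).flip v) τ = 0)

/-- The action of the quadratic ring on the product of the `V i`. -/
def quadraticRingAction : QuadraticRing 𝕜 k Q →ₐ[𝕜] Module.End 𝕜 (∀ i, V i) :=
  RingQuot.liftAlgHom 𝕜 ⟨tensorRingAction γ hl hr, by
    rintro x y ⟨τ, hτ⟩
    ext w i : 2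
    rw [tensorRingAction_ι₂, hQ i _ τ hτ, map_zero]
    rfl⟩

theorem quadraticRingAction_mk (x : TensorRing 𝕜 k F) :
    quadraticRingAction γ hl hr hQ (QuadraticRing.mk 𝕜 k Q x) = tensorRingAction γ hl hr x :=
  RingQuot.liftAlgHom_mkAlgHom_apply 𝕜 _ _ _

theorem quadraticRing_component_zero : QuadraticRing.component 𝕜 k Q 0 =
    LinearMap.range ((QuadraticRing.mk 𝕜 k Q).comp (TensorRing.base 𝕜 k F)).toLinearMap := by
  rw [QuadraticRing.component, TensorRing.component, pow_zero, mul_one, AlgHom.comp_toLinearMap,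
    LinearMap.range_comp]

theorem quadraticRing_component_succ (n : ℕ) : QuadraticRing.component 𝕜 k Q (n + 1) =
    QuadraticRing.component 𝕜 k Q n *
      LinearMap.range ((QuadraticRing.mk 𝕜 k Q).toLinearMap ∘ₗ TensorRing.ι 𝕜 k F) := by
  rw [QuadraticRing.component, TensorRing.component, pow_succ, ← mul_assoc, Submodule.map_mul,
    LinearMap.range_comp]
  rfl

theorem mul_base_mem_quadraticRing_component {n : ℕ} (a : k) {b : QuadraticRing 𝕜 k Q}
    (hb : b ∈ QuadraticRing.component 𝕜 k Q n) :
    b * QuadraticRing.mk 𝕜 k Q (TensorRing.base 𝕜 k F a) ∈ QuadraticRing.component 𝕜 k Q n := by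
  rcases n with _ | n
  · rw [quadraticRing_component_zero] at hb ⊢
    obtain ⟨r, rfl⟩ := hb
    exact ⟨r * a, map_mul ((QuadraticRing.mk 𝕜 k Q).comp (TensorRing.base 𝕜 k F)) r a⟩
  · rw [quadraticRing_component_succ] at hb ⊢
    induction hb using Submodule.mul_induction_on' with
    | mem_mul_mem b hb c hc =>
      obtain ⟨f, rfl⟩ := hc
      rw [mul_assoc]
      refine Submodule.mul_mem_mul hb ⟨MulOpposite.op a • f, ?_⟩
      change QuadraticRing.mk 𝕜 k Q _ = QuadraticRing.mk 𝕜 k Q _ * QuadraticRing.mk 𝕜 k Q _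
      rw [TensorRing.ι_op_smul, map_mul]
    | add x _ y _ hx hy => rw [add_mul]; exact add_mem hx hy

/-- A nonzero element of a module over a semisimple ring is detected by a linear form. -/
theorem exists_linearMap_apply_ne_zero {K M : Type*} [Ring K] [IsSemisimpleRing K]
    [AddCommGroup M] [Module K M] {x : M} (hx : x ≠ 0) : ∃ h : M →ₗ[K] K, h x ≠ 0 := by
  have := Module.projective_of_isSemisimpleRing K M
  obtain ⟨s, hs⟩ := Module.projective_def.1 this
  have hsx : s x ≠ 0 := fun h => hx (by rw [← hs x, h, map_zero])
  obtain ⟨y, hy⟩ := Finsupp.ne_iff.1 hsx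
  exact ⟨(Finsupp.lapply y).comp s, hy⟩

variable (hsep : ∀ i (v : V (i + 1)), (∀ f, γ i f v = 0) → v = 0)

-- The pairing of degree `n` elements `b` with `V n`, taking `v` to the `V 0` component of `b v`,
-- has no kernel in `V n`: by `hsep` one factor of `F` at a time detects `v`.
include hsep in
theorem eq_zero_of_quadraticRingAction_eq_zero (n : ℕ) (v : V n)
    (h : ∀ b ∈ QuadraticRing.component 𝕜 k Q n,
      quadraticRingAction γ hl hr hQ b (Pi.single n v) 0 = 0) : v = 0 := by
  induction n with
  | zero =>
    have := h (QuadraticRing.mk 𝕜 k Q (TensorRing.base 𝕜 k F 1)) (by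
      rw [quadraticRing_component_zero]
      exact ⟨1, rfl⟩)
    rw [quadraticRingAction_mk, tensorRingAction_base, one_smul, Pi.single_eq_same] at this
    exact this
  | succ n ih =>
    refine hsep n v fun f => ih _ fun b hb => ?_
    have := h (b * QuadraticRing.mk 𝕜 k Q (TensorRing.ι 𝕜 k F f)) (by
      rw [quadraticRing_component_succ]
      exact Submodule.mul_mem_mul hb ⟨f, rfl⟩)
    rw [map_mul, Module.End.mul_apply, quadraticRingAction_mk] at this
    convert this using 3
    ext i
    rw [tensorRingAction_ι]
    by_cases hi : i = n
    · subst hi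
      rw [Pi.single_eq_same, Pi.single_eq_same]
    · rw [Pi.single_eq_of_ne hi, Pi.single_eq_of_ne (by omega), map_zero]

theorem quadraticRingAction_ι_single (n : ℕ) (v : V (n + 1)) (f : F) :
    quadraticRingAction γ hl hr hQ (QuadraticRing.mk 𝕜 k Q (TensorRing.ι 𝕜 k F f))
      (Pi.single (n + 1) v) = Pi.single n (γ n f v) := by
  rw [quadraticRingAction_mk]
  ext i
  rw [tensorRingAction_ι]
  by_cases hi : i = n
  · subst hi
    rw [Pi.single_eq_same, Pi.single_eq_same]
  · rw [Pi.single_eq_of_ne hi, Pi.single_eq_of_ne (by omega), map_zero]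

variable [IsScalarTower 𝕜 k F]
  (hsol_zero : ∀ u : F →ₗ[𝕜] V 0, (∀ (a : k) f, u (a • f) = a • u f) → ∃ v, ∀ f, γ 0 f v = u f)
  (hsol : ∀ i (u : F →ₗ[𝕜] V (i + 1)), (∀ (a : k) f, u (a • f) = a • u f) →
    (∀ τ ∈ Q, contract (γ i) u τ = 0) → ∃ v, ∀ f, γ (i + 1) f v = u f)

-- The other half of perfectness: every `k`-linear form on degree `n` with values in `V 0` is
-- pairing with an element of `V n`. Inductively `b ↦ h (b f)` is pairing with some `u f`, and
-- `hsol` integrates the family `u` to one element.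
include hsep hsol_zero hsol in
theorem exists_quadraticRingAction_eq (n : ℕ) (h : QuadraticRing 𝕜 k Q →ₗ[𝕜] V 0)
    (hh : ∀ (a : k) b, h (QuadraticRing.mk 𝕜 k Q (TensorRing.base 𝕜 k F a) * b) = a • h b) :
    ∃ v : V n, ∀ b ∈ QuadraticRing.component 𝕜 k Q n,
      quadraticRingAction γ hl hr hQ b (Pi.single n v) 0 = h b := by
  induction n generalizing h with
  | zero =>
    refine ⟨h 1, fun b hb => ?_⟩
    rw [quadraticRing_component_zero] at hb
    obtain ⟨r, rfl⟩ := hb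
    change quadraticRingAction γ hl hr hQ
      (QuadraticRing.mk 𝕜 k Q (TensorRing.base 𝕜 k F r)) _ 0 =
      h (QuadraticRing.mk 𝕜 k Q (TensorRing.base 𝕜 k F r))
    rw [quadraticRingAction_mk, tensorRingAction_base, Pi.smul_apply, Pi.single_eq_same, ← hh,
      mul_one]
  | succ n ih =>
    let m : F →ₗ[𝕜] QuadraticRing 𝕜 k Q := (QuadraticRing.mk 𝕜 k Q).toLinearMap ∘ₗ
      TensorRing.ι 𝕜 k F
    choose u hu using fun f : F => ih (h ∘ₗ LinearMap.mulRight 𝕜 (m f)) fun a b => by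
      change h (_ * b * _) = a • h (b * _)
      rw [mul_assoc, hh]
    -- The `u f` are mere choices; uniqueness makes them linear in `f`.
    have huniq : ∀ v w : V n, (∀ b ∈ QuadraticRing.component 𝕜 k Q n,
        quadraticRingAction γ hl hr hQ b (Pi.single n v) 0 =
        quadraticRingAction γ hl hr hQ b (Pi.single n w) 0) → v = w := fun v w hvw => by
      rw [← sub_eq_zero]
      refine eq_zero_of_quadraticRingAction_eq_zero γ hl hr hQ hsep n _ fun b hb => ?_
      rw [Pi.single_sub, map_sub, Pi.sub_apply, hvw b hb, sub_self]
    have hu' : ∀ f, ∀ b ∈ QuadraticRing.component 𝕜 k Q n,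
        quadraticRingAction γ hl hr hQ b (Pi.single n (u f)) 0 = h (b * m f) := hu
    have hbs : ∀ (a : k) b (v : V n), quadraticRingAction γ hl hr hQ
        (b * QuadraticRing.mk 𝕜 k Q (TensorRing.base 𝕜 k F a)) (Pi.single n v) =
        quadraticRingAction γ hl hr hQ b (Pi.single n (a • v)) := fun a b v => by
      rw [map_mul, Module.End.mul_apply, quadraticRingAction_mk, Pi.single_smul]
      congr 1
      exact tensorRingAction_base γ hl hr a _
    have hma : ∀ (a : k) f, m (a • f) =
        QuadraticRing.mk 𝕜 k Q (TensorRing.base 𝕜 k F a) * m f := fun a f => by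
      change QuadraticRing.mk 𝕜 k Q _ = QuadraticRing.mk 𝕜 k Q _ * QuadraticRing.mk 𝕜 k Q _
      rw [TensorRing.ι_smul, map_mul]
    have huk : ∀ (a : k) f, u (a • f) = a • u f := fun a f => huniq _ _ fun b hb => by
      rw [hu' _ b hb, ← hbs, hu' _ _ (mul_base_mem_quadraticRing_component a hb), hma, mul_assoc]
    let U : F →ₗ[𝕜] V n :=
      { toFun := u
        map_add' := fun f g => huniq _ _ fun b hb => by
          rw [hu' _ b hb, Pi.single_add, (quadraticRingAction γ hl hr hQ b).map_add]
          refine Eq.trans ?_ (Pi.add_apply _ _ 0).symm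
          rw [hu' _ b hb, hu' _ b hb, map_add,
            mul_add, map_add]
        map_smul' := fun c f => by
          rw [← algebraMap_smul k c f, huk, algebraMap_smul]
          rfl }
    obtain ⟨v, hv⟩ : ∃ v : V (n + 1), ∀ f, γ n f v = U f := by
      rcases n with _ | n
      · exact hsol_zero U huk
      · refine hsol n U huk fun τ hτ => ?_
        refine eq_zero_of_quadraticRingAction_eq_zero γ hl hr hQ hsep n _ fun b hb => ?_
        -- Contracting `U` with `τ` represents the form `b ↦ h (b τ)`, which is zero for a relation
        -- `τ`. So `U` satisfies the equations required by `hsol`.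
        have key : ∀ τ : F ⊗[𝕜] F, quadraticRingAction γ hl hr hQ b
            (Pi.single n (contract (γ n) U τ)) 0 =
            h (b * QuadraticRing.mk 𝕜 k Q (TensorRing.ι₂ 𝕜 k F τ)) := fun τ => by
          induction τ with
          | zero => simp
          | add x y hx hy => simp only [map_add, Pi.single_add, Pi.add_apply, hx, hy, mul_add]
          | tmul f g =>
            rw [contract_tmul, ← quadraticRingAction_ι_single γ hl hr hQ, ← Module.End.mul_apply,
              ← map_mul]
            have := hu' g (b * m f) (by
              rw [quadraticRing_component_succ]
              exact Submodule.mul_mem_mul hb ⟨f, rfl⟩)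
            refine this.trans ?_
            rw [mul_assoc]
            change h (b * (QuadraticRing.mk 𝕜 k Q _ * QuadraticRing.mk 𝕜 k Q _)) = _
            rw [← map_mul]
            rfl
        have h0 : QuadraticRing.mk 𝕜 k Q (TensorRing.ι₂ 𝕜 k F τ) = 0 :=
          (RingQuot.mkAlgHom_rel 𝕜 (QuadraticRing.Rel.rel τ hτ)).trans (map_zero _)
        rw [key, h0, mul_zero, map_zero]
    refine ⟨v, fun b hb => ?_⟩
    rw [quadraticRing_component_succ] at hb
    induction hb using Submodule.mul_induction_on' with
    | mem_mul_mem b hb c hc =>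
      obtain ⟨f, rfl⟩ := hc
      rw [map_mul, Module.End.mul_apply]
      refine (congrArg (fun t : ∀ i, V i => quadraticRingAction γ hl hr hQ b t 0)
        (quadraticRingAction_ι_single γ hl hr hQ n v f)).trans ?_
      rw [hv]
      exact hu' f b hb
    | add x _ y _ hx hy => rw [map_add, LinearMap.add_apply, Pi.add_apply, hx, hy, map_add]

include hl hr hQ hsep hsol_zero hsol in
/-- The components of the quadratic ring `T_k(F) / (Q)` vanish if and only if those of its graded
dual `V` do, which is characterized by its contraction operators `γ`. -/
theorem quadraticRing_component_eq_bot_iff [IsSemisimpleRing k] (j : k →ₗ[k] V 0)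
    (hj : Function.Injective j) (n : ℕ) :
    QuadraticRing.component 𝕜 k Q n = ⊥ ↔ ∀ v : V n, v = 0 := by
  constructor
  · intro h v
    refine eq_zero_of_quadraticRingAction_eq_zero γ hl hr hQ hsep n v fun b hb => ?_
    rw [h, Submodule.mem_bot] at hb
    rw [hb, map_zero]
    rfl
  · intro h
    rw [Submodule.eq_bot_iff]
    intro x hx
    by_contra hne
    let κ : k →+* QuadraticRing 𝕜 k Q :=
      ((QuadraticRing.mk 𝕜 k Q).comp (TensorRing.base 𝕜 k F)).toRingHom
    let : Module k (QuadraticRing 𝕜 k Q) := Module.compHom _ κ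
    have hsmul : ∀ (a : k) (b : QuadraticRing 𝕜 k Q), a • b = κ a * b := fun _ _ => rfl
    have : IsScalarTower 𝕜 k (QuadraticRing 𝕜 k Q) := ⟨fun c a b => by
      rw [hsmul, hsmul]
      have : κ (c • a) = c • κ a :=
        map_smul ((QuadraticRing.mk 𝕜 k Q).comp (TensorRing.base 𝕜 k F)) c a
      rw [this, smul_mul_assoc]⟩
    -- A `k`-linear form that is nonzero on `x`, pushed into `V 0` by `j`, is pairing with an
    -- element of `V n`; as `V n` is zero, the form would vanish at `x`.
    obtain ⟨f, hf⟩ := exists_linearMap_apply_ne_zero (K := k) hne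
    obtain ⟨v, hv⟩ := exists_quadraticRingAction_eq γ hl hr hQ hsep hsol_zero hsol n
      ((j.comp f).restrictScalars 𝕜) fun a b => (j.comp f).map_smul a b
    have := hv x hx
    rw [h v, Pi.single_zero, map_zero] at this
    exact hf (hj (this.symm.trans (map_zero j).symm))

end Contraction

end KoszulDual

end

/-! ### The generators of a linear resolution as the graded dual of the quadratic dual. -/

noncomputable section

namespace KoszulDual

universe u

section StructMap

variable {𝕜 k : Type*} {A : Type u} [Field 𝕜] [Ring k] [Algebra 𝕜 k] [Ring A] [Algebra 𝕜 A]
  {𝒜 : ℕ → Submodule 𝕜 A} [GradedAlgebra 𝒜] (φ : k ≃ₐ[𝕜] 𝒜 0)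

/-- The structure map of a connected graded `k`-algebra. -/
def structMap : k →+* A where
  toFun r := φ r
  map_one' := by simp
  map_mul' r s := by simp
  map_zero' := by simp
  map_add' r s := by simp

theorem structMap_apply (r : k) : structMap φ r = φ r := rfl

theorem structMap_mem (r : k) : structMap φ r ∈ 𝒜 0 := (φ r).2

theorem structMap_injective : Function.Injective (structMap φ) := fun _ _ h =>
  φ.injective (Subtype.ext h)

theorem exists_structMap_eq {a : A} (ha : a ∈ 𝒜 0) : ∃ r, structMap φ r = a :=
  ⟨φ.symm ⟨a, ha⟩, by rw [structMap_apply, AlgEquiv.apply_symm_apply]⟩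

theorem proj_structMap_mul (m : ℕ) (r : k) (a : A) :
    GradedRing.proj 𝒜 m (structMap φ r * a) = structMap φ r * GradedRing.proj 𝒜 m a := by
  rw [GradedRing.proj_apply, GradedRing.proj_apply,
    DirectSum.coe_decompose_mul_of_left_mem_of_le 𝒜 (structMap_mem φ r) (Nat.zero_le m),
    Nat.sub_zero]

theorem proj_mul_structMap (m : ℕ) (a : A) (r : k) :
    GradedRing.proj 𝒜 m (a * structMap φ r) = GradedRing.proj 𝒜 m a * structMap φ r := by
  rw [GradedRing.proj_apply, GradedRing.proj_apply,
    DirectSum.coe_decompose_mul_of_right_mem_of_le 𝒜 (structMap_mem φ r) (Nat.zero_le m),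
    Nat.sub_zero]

/-- `A` as a right `k`-module. -/
abbrev rightModule : Module kᵐᵒᵖ A := Module.compHom A (structMap φ).op

/-- A dual basis of `A` as a right `k`-module. -/
theorem exists_dualBasis [IsSemisimpleRing k] : ∃ s : A →+ (A →₀ k),
    (∀ a r y, s (a * structMap φ r) y = s a y * r) ∧
      ∀ a, ((s a).sum fun y c => y * structMap φ c) = a := by
  let := rightModule φ
  obtain ⟨s, hs⟩ := Module.projective_def.1 (Module.projective_of_isSemisimpleRing kᵐᵒᵖ A)
  refine ⟨(Finsupp.mapRange.addMonoidHom MulOpposite.opAddEquiv.symm.toAddMonoidHom).comp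
    s.toAddMonoidHom, fun a r y => ?_, fun a => ?_⟩
  · exact congrArg MulOpposite.unop (DFunLike.congr_fun (s.map_smul (MulOpposite.op r) a) y)
  · conv_rhs => rw [← hs a]
    rw [Finsupp.linearCombination_apply]
    exact Finsupp.sum_mapRange_index (hf := rfl) fun y => by simp

/-- The projection `A → A₁`. -/
def projOne : A →+ DegreeOne φ where
  toFun a := (⟨GradedRing.proj 𝒜 1 a, SetLike.coe_mem _⟩ : 𝒜 1)
  map_zero' := DegreeOne.ext (map_zero (GradedRing.proj 𝒜 1))
  map_add' x y := DegreeOne.ext (map_add (GradedRing.proj 𝒜 1) x y)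

@[simp] theorem incl_projOne (a : A) :
    DegreeOne.incl φ (projOne φ a) = GradedRing.proj 𝒜 1 a := rfl

theorem projOne_mul_structMap (a : A) (r : k) :
    projOne φ (a * structMap φ r) = MulOpposite.op r • projOne φ a :=
  DegreeOne.ext (proj_mul_structMap φ 1 a r)

theorem projOne_structMap_mul (a : A) (r : k) :
    projOne φ (structMap φ r * a) = r • projOne φ a :=
  DegreeOne.ext (proj_structMap_mul φ 1 r a)

theorem projOne_incl (x : DegreeOne φ) : projOne φ (DegreeOne.incl φ x) = x :=
  DegreeOne.ext (by
    rw [incl_projOne, GradedRing.proj_apply, DirectSum.decompose_of_mem_same _ x.incl_mem])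

theorem projOne_proj (a : A) : projOne φ (GradedRing.proj 𝒜 1 a) = projOne φ a :=
  projOne_incl φ (projOne φ a)

/-- An element of the dual of `A₁` as a functional on `A`. -/
def extendOne (f : RightDual k (DegreeOne φ)) : A →+ k :=
  (f : DegreeOne φ →+ k).comp (projOne φ)

theorem extendOne_apply (f : RightDual k (DegreeOne φ)) (a : A) :
    extendOne φ f a = f (projOne φ a) := rfl

theorem extendOne_mul_structMap (f : RightDual k (DegreeOne φ)) (a : A) (r : k) :
    extendOne φ f (a * structMap φ r) = extendOne φ f a * r := by
  rw [extendOne_apply, projOne_mul_structMap, f.map_op_smul]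
  rfl

theorem extendOne_incl (f : RightDual k (DegreeOne φ)) (x : DegreeOne φ) :
    extendOne φ f (DegreeOne.incl φ x) = f x := by
  rw [extendOne_apply, projOne_incl]

/-- A finite dual basis of a bimodule, finitely generated on the right. -/
theorem exists_finite_dualBasis {E : Type*} [AddCommGroup E] [Module kᵐᵒᵖ E]
    [Module.Finite kᵐᵒᵖ E] [IsSemisimpleRing k] : ∃ (n : ℕ) (e : Fin n → E)
      (f : Fin n → RightDual k E), ∀ x, ∑ j, MulOpposite.op (f j x) • e j = x := by
  have := Module.projective_of_isSemisimpleRing kᵐᵒᵖ E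
  obtain ⟨n, p, hp⟩ := Module.Finite.exists_fin' kᵐᵒᵖ E
  obtain ⟨s, hs⟩ := Module.projective_lifting_property p LinearMap.id hp
  refine ⟨n, fun j => p (Pi.single j 1), fun j =>
    ({ toFun := fun x => (s x j).unop
       map_add' := fun x y => by simp
       map_smul' := fun r x => by simp } : E →ₗ[kᵐᵒᵖ] k), fun x => ?_⟩
  have h := LinearMap.congr_fun hs x
  refine Eq.trans ?_ h
  rw [LinearMap.comp_apply]
  conv_rhs => rw [← Finset.univ_sum_single (s x), map_sum]
  refine Finset.sum_congr rfl fun j _ => ?_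
  rw [← map_smul]
  congr 1
  rw [← Pi.single_smul, smul_eq_mul, mul_one]
  rfl

/-- A tensor in `Q^⊥` defines a right `k`-linear functional on `A₁A₁`, and this extends to `A`. -/
theorem exists_extension_of_mem_perp [IsSemisimpleRing k]
    {τ : RightDual k (DegreeOne φ) ⊗[𝕜] RightDual k (DegreeOne φ)}
    (hτ : τ ∈ perp (k := k) (quadraticRelations φ)) : ∃ ψ : A →+ k,
    (∀ a r, ψ (a * structMap φ r) = ψ a * r) ∧
      ∀ x y : DegreeOne φ, ψ (DegreeOne.incl φ x * DegreeOne.incl φ y) = pairing τ (x ⊗ₜ y) := by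
  let := rightModule φ
  let μ : DegreeOne φ ⊗[𝕜] DegreeOne φ →ₗ[𝕜] A := LinearMap.mul' 𝕜 A ∘ₗ
    TensorProduct.map (DegreeOne.incl φ) (DegreeOne.incl φ)
  have hμ : ∀ x y, μ (x ⊗ₜ y) = DegreeOne.incl φ x * DegreeOne.incl φ y := fun _ _ => rfl
  let ρ (r : k) : DegreeOne φ →ₗ[𝕜] DegreeOne φ :=
    { toFun := fun x => MulOpposite.op r • x
      map_add' := smul_add _
      map_smul' := fun c x => DegreeOne.ext (by simp) }
  have hρμ : ∀ r t, μ ((ρ r).lTensor _ t) = μ t * structMap φ r := fun r t => by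
    induction t with
    | zero => simp
    | add x y hx hy => simp only [map_add, hx, hy, add_mul]
    | tmul x y =>
      rw [LinearMap.lTensor_tmul, hμ, hμ, mul_assoc]
      rfl
  have hρτ : ∀ r t, pairing τ ((ρ r).lTensor _ t) = pairing τ t * r := fun r t => by
    induction t with
    | zero => simp
    | add x y hx hy => simp only [map_add, hx, hy, add_mul]
    | tmul x y =>
      rw [LinearMap.lTensor_tmul]
      clear hτ
      induction τ with
      | zero => simp
      | add σ τ hσ hτ => simp only [map_add, LinearMap.add_apply, hσ, hτ, add_mul]
      | tmul f g =>
        change f (g x • MulOpposite.op r • y) = f (g x • y) * r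
        rw [smul_comm, f.map_op_smul]
  -- Vanishing on the kernel `Q` of `μ` means that the pairing with `τ` descends to the image of
  -- `μ`.
  have hwd : ∀ t t', μ t = μ t' → pairing τ t = pairing τ t' := fun t t' h => by
    rw [← sub_eq_zero, ← map_sub]
    exact hτ _ (LinearMap.mem_ker.2 (by rw [← sub_eq_zero, ← map_sub] at h; exact h))
  let N : Submodule kᵐᵒᵖ A :=
    { carrier := LinearMap.range μ
      zero_mem' := zero_mem (LinearMap.range μ)
      add_mem' := fun hx hy => add_mem (S := Submodule 𝕜 A) hx hy
      smul_mem' := by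
        rintro r _ ⟨t, rfl⟩
        exact ⟨_, hρμ r.unop t⟩ }
  choose t ht using fun x : N => x.2
  let ψ₀ : N →ₗ[kᵐᵒᵖ] k :=
    { toFun := fun x => pairing τ (t x)
      map_add' := fun x y => by
        rw [← map_add]
        exact hwd _ _ (by rw [map_add, ht, ht, ht]; rfl)
      map_smul' := fun r x => by
        refine Eq.trans ?_ (hρτ r.unop (t x))
        exact hwd _ _ (by rw [hρμ, ht, ht]; rfl) }
  obtain ⟨W, hW⟩ := exists_isCompl N
  let ψ := ψ₀ ∘ₗ N.projectionOnto W hW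
  refine ⟨ψ.toAddMonoidHom, fun a r => ψ.map_smul (MulOpposite.op r) a, fun x y => ?_⟩
  have h : N.projectionOnto W hW (μ (x ⊗ₜ y)) = ⟨μ (x ⊗ₜ y), _, rfl⟩ :=
    Submodule.projectionOnto_apply_left hW ⟨μ (x ⊗ₜ y), _, rfl⟩
  change ψ₀ (N.projectionOnto W hW (μ (x ⊗ₜ y))) = _
  rw [h]
  exact hwd _ _ (ht _)

end StructMap

section RightDual

variable {k E : Type*} [Ring k] [AddCommGroup E] [Module kᵐᵒᵖ E] {𝕜 : Type*} [Field 𝕜]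
  [Algebra 𝕜 k]

instance : IsScalarTower 𝕜 k (RightDual k E) :=
  ⟨fun c a f => RightDual.ext fun x => by simp⟩

end RightDual

namespace LinearResolution

variable {𝕜 k : Type*} {A : Type u} [Field 𝕜] [Ring k] [Algebra 𝕜 k] [Ring A] [Algebra 𝕜 A]
  {𝒜 : ℕ → Submodule 𝕜 A} [GradedAlgebra 𝒜] (L : LinearResolution 𝒜) (φ : k ≃ₐ[𝕜] 𝒜 0)

/-- The generators of `P i`, as a left `k`-module. -/
def Gen (_φ : k ≃ₐ[𝕜] 𝒜 0) (i : ℕ) : Type u := L.deg i i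

namespace Gen

variable (i : ℕ)

instance : AddCommGroup (L.Gen φ i) := inferInstanceAs (AddCommGroup (L.deg i i))

/-- The inclusion of the generators into `P i`. -/
def val : L.Gen φ i →+ L.P i := (L.deg i i).subtype

variable {L φ i}

theorem val_mem (v : L.Gen φ i) : val L φ i v ∈ L.deg i i := Subtype.property (p := (· ∈ L.deg i i)) v

@[ext] theorem ext {v w : L.Gen φ i} (h : val L φ i v = val L φ i w) : v = w := Subtype.ext h

instance : Module k (L.Gen φ i) where
  smul r v := (⟨structMap φ r • val L φ i v, by
    simpa only [zero_add] using L.smul_mem i 0 i _ _ (structMap_mem φ r) (val_mem v)⟩ : L.deg i i)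
  one_smul v := ext (show structMap φ 1 • val L φ i v = _ by rw [map_one, one_smul])
  mul_smul r s v := ext (show structMap φ (r * s) • val L φ i v =
      structMap φ r • structMap φ s • val L φ i v by
    rw [map_mul, mul_smul])
  smul_zero r := ext (show structMap φ r • val L φ i 0 = val L φ i 0 by rw [map_zero, smul_zero])
  zero_smul v := ext (show structMap φ 0 • val L φ i v = val L φ i 0 by rw [map_zero, zero_smul, map_zero])
  smul_add r v w := ext (show structMap φ r • val L φ i (v + w) =
    structMap φ r • val L φ i v + structMap φ r • val L φ i w by rw [map_add, smul_add])
  add_smul r s v := ext (show structMap φ (r + s) • val L φ i v =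
    structMap φ r • val L φ i v + structMap φ s • val L φ i v by rw [map_add, add_smul])

theorem val_smul (r : k) (v : L.Gen φ i) : val L φ i (r • v) = structMap φ r • val L φ i v := rfl

instance : Module 𝕜 (L.Gen φ i) := Module.compHom _ (algebraMap 𝕜 k)

theorem field_smul_def (c : 𝕜) (v : L.Gen φ i) : c • v = algebraMap 𝕜 k c • v := rfl

instance : IsScalarTower 𝕜 k (L.Gen φ i) :=
  ⟨fun c r v => by rw [Algebra.smul_def, mul_smul]; rfl⟩

end Gen

theorem exists_section (i : ℕ) : ∃ s : L.P i →ₗ[A] (L.Gen φ i →₀ A),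
    ∀ p, Finsupp.linearCombination A (Gen.val L φ i) (s p) = p := by
  have hsurj : Function.Surjective (Finsupp.linearCombination A (Gen.val L φ i)) := by
    rw [← LinearMap.range_eq_top, Finsupp.range_linearCombination, ← L.generated i]
    congr 1
    exact Subtype.range_coe
  obtain ⟨s, hs⟩ := Module.projective_lifting_property _ LinearMap.id hsurj
  exact ⟨s, LinearMap.congr_fun hs⟩

/-- An `A`-linear section of the map from the free module on the generators to `P i`. -/
def sec (i : ℕ) : L.P i →ₗ[A] (L.Gen φ i →₀ A) := (L.exists_section φ i).choose

theorem sum_sec (i : ℕ) (p : L.P i) : ((L.sec φ i p).sum fun w x => x • Gen.val L φ i w) = p :=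
  (L.exists_section φ i).choose_spec p

/-- An element of degree `m + i` of `P i` is a combination of generators with coefficients of
degree `m`. -/
theorem sum_proj_sec {i m : ℕ} {p : L.P i} (hp : p ∈ L.deg i (m + i)) :
    ((L.sec φ i p).sum fun w x => GradedRing.proj 𝒜 m x • Gen.val L φ i w) = p := by
  rw [← L.comp_of_mem hp]
  conv_rhs => rw [← L.sum_sec φ i p]
  rw [Finsupp.sum, Finsupp.sum, map_sum, L.comp_of_mem hp]
  refine Finset.sum_congr rfl fun w _ => ?_
  rw [comp, homComponent_smul_of_mem _ (L.smul_mem i) (Gen.val_mem w), if_pos (by omega),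
    Nat.add_sub_cancel]

/-- The contraction of `P i` in degree `m + i` with a functional on `A` in degree `m`. -/
def contr (i m : ℕ) (ψ : A →+ k) : L.P i →+ L.Gen φ i :=
  (Finsupp.liftAddHom fun w => ((smulAddHom k (L.Gen φ i)).flip w).comp
    (ψ.comp (GradedRing.proj 𝒜 m))).comp (L.sec φ i).toAddMonoidHom

theorem contr_apply (i m : ℕ) (ψ : A →+ k) (p : L.P i) : L.contr φ i m ψ p =
    (L.sec φ i p).sum fun w x => ψ (GradedRing.proj 𝒜 m x) • w := rfl

/-- `P i` behaves like `A ⊗_k V_i`: although `sec` is a choice, the contraction of `a v` is `ψ(a)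
v`. The degree zero coefficients of `sec v` recombine to `v`, and right `k`-linearity of `ψ` moves
them out. -/
theorem contr_smul_val {i m : ℕ} {ψ : A →+ k} (hψ : ∀ a r, ψ (a * structMap φ r) = ψ a * r)
    {a : A} (ha : a ∈ 𝒜 m) (v : L.Gen φ i) :
    L.contr φ i m ψ (a • Gen.val L φ i v) = ψ a • v := by
  choose ρ hρ using fun x : A => exists_structMap_eq φ (SetLike.coe_mem (DirectSum.decompose 𝒜 x 0))
  have hv : ((L.sec φ i (Gen.val L φ i v)).sum fun w x => ρ x • w) = v := by
    ext
    rw [Finsupp.sum, map_sum]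
    conv_rhs => rw [← L.sum_proj_sec φ (m := 0) (p := Gen.val L φ i v)
      (by rw [zero_add]; exact Gen.val_mem v)]
    refine Finset.sum_congr rfl fun w _ => ?_
    rw [Gen.val_smul, hρ]
    rfl
  conv_rhs => rw [← hv]
  rw [contr_apply, map_smul, Finsupp.sum_smul_index' fun w => by simp, Finsupp.smul_sum]
  refine Finset.sum_congr rfl fun w _ => ?_
  simp only
  rw [smul_smul, ← hψ, hρ, smul_eq_mul, GradedRing.proj_apply,
    DirectSum.coe_decompose_mul_of_left_mem_of_le 𝒜 ha le_rfl, Nat.sub_self]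

/-- Expanding the coefficients of `p` in a dual basis of `A` over `k` on the right, the part of `p`
along each basis element `y` is `y` times a contraction of `p`. -/
theorem eq_zero_of_contr_eq_zero [IsSemisimpleRing k] {i m : ℕ} {p : L.P i}
    (hp : p ∈ L.deg i (m + i)) (h : ∀ ψ : A →+ k, (∀ a r, ψ (a * structMap φ r) = ψ a * r) →
      L.contr φ i m ψ p = 0) : p = 0 := by
  classical
  obtain ⟨s, hs, hs'⟩ := exists_dualBasis φ
  let X : L.Gen φ i → A := fun w => GradedRing.proj 𝒜 m (L.sec φ i p w)
  let S := (L.sec φ i p).support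
  let T := S.biUnion fun w => (s (X w)).support
  have h1 : p = ∑ w ∈ S, X w • Gen.val L φ i w := (L.sum_proj_sec φ hp).symm
  have h2 : ∀ w ∈ S, X w = ∑ y ∈ T, y * structMap φ (s (X w) y) := fun w hw => by
    conv_lhs => rw [← hs' (X w)]
    exact Finsupp.sum_of_support_subset _ (Finset.subset_biUnion_of_mem
      (fun w => (s (X w)).support) hw) _ (by simp)
  rw [h1, Finset.sum_congr rfl fun w hw => by rw [h2 w hw, Finset.sum_smul], Finset.sum_comm]
  refine Finset.sum_eq_zero fun y _ => ?_
  have h3 := congrArg (Gen.val L φ i) (h ((Finsupp.applyAddHom y).comp s) fun a r => hs a r y)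
  rw [contr_apply, Finsupp.sum, map_sum, map_zero] at h3
  simp only [Gen.val_smul] at h3
  simp only [mul_smul]
  rw [← Finset.smul_sum]
  exact (congrArg (y • ·) h3).trans (smul_zero y)

theorem contr_add (i m : ℕ) (ψ ψ' : A →+ k) (p : L.P i) :
    L.contr φ i m (ψ + ψ') p = L.contr φ i m ψ p + L.contr φ i m ψ' p := by
  simp only [contr_apply, AddMonoidHom.add_apply, add_smul, Finsupp.sum_add]

theorem contr_extendOne_smul (i : ℕ) (a : k) (f : RightDual k (DegreeOne φ)) (p : L.P i) :
    L.contr φ i 1 (extendOne φ (a • f)) p = a • L.contr φ i 1 (extendOne φ f) p := by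
  simp only [contr_apply, extendOne_apply, RightDual.smul_apply, mul_smul, Finsupp.smul_sum]

theorem contr_extendOne_op_smul (i : ℕ) (a : k) (f : RightDual k (DegreeOne φ)) (p : L.P i) :
    L.contr φ i 1 (extendOne φ (MulOpposite.op a • f)) p =
      L.contr φ i 1 (extendOne φ f) (structMap φ a • p) := by
  rw [contr_apply, contr_apply, map_smul, Finsupp.sum_smul_index' fun w => by simp]
  refine Finset.sum_congr rfl fun w _ => ?_
  simp only
  rw [extendOne_apply, extendOne_apply, RightDual.op_smul_apply, smul_eq_mul, projOne_proj,
    projOne_proj, projOne_structMap_mul]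

theorem d_val_smul (i : ℕ) (a : k) (v : L.Gen φ (i + 1)) :
    L.d i (Gen.val L φ (i + 1) (a • v)) = structMap φ a • L.d i (Gen.val L φ (i + 1) v) := by
  rw [Gen.val_smul, map_smul]

/-- The contraction operators `E^* × V_{i+1} → V_i` on the generators of a linear resolution. -/
def γ (i : ℕ) : RightDual k (DegreeOne φ) →ₗ[𝕜] L.Gen φ (i + 1) →ₗ[𝕜] L.Gen φ i :=
  LinearMap.mk₂ 𝕜 (fun f v => L.contr φ i 1 (extendOne φ f) (L.d i (Gen.val L φ (i + 1) v)))
    (fun f g v => contr_add L φ i 1 (extendOne φ f) (extendOne φ g) _)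
    (fun c f v => by
      rw [← algebraMap_smul k c f, contr_extendOne_smul]
      rfl)
    (fun f v w => by rw [map_add, map_add, map_add])
    (fun c f v => by
      rw [Gen.field_smul_def, d_val_smul, ← contr_extendOne_op_smul, Gen.field_smul_def,
        ← contr_extendOne_smul]
      refine congrArg (fun h => L.contr φ i 1 (extendOne φ h) _) (RightDual.ext fun x => ?_)
      rw [RightDual.op_smul_apply, RightDual.smul_apply, algebraMap_smul, f.map_field_smul,
        Algebra.smul_def])

theorem γ_apply (i : ℕ) (f : RightDual k (DegreeOne φ)) (v : L.Gen φ (i + 1)) :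
    L.γ φ i f v = L.contr φ i 1 (extendOne φ f) (L.d i (Gen.val L φ (i + 1) v)) := rfl

theorem γ_smul (i : ℕ) (a : k) (f : RightDual k (DegreeOne φ)) (v : L.Gen φ (i + 1)) :
    L.γ φ i (a • f) v = a • L.γ φ i f v := contr_extendOne_smul _ _ _ _ _ _

theorem γ_op_smul (i : ℕ) (a : k) (f : RightDual k (DegreeOne φ)) (v : L.Gen φ (i + 1)) :
    L.γ φ i (MulOpposite.op a • f) v = L.γ φ i f (a • v) := by
  rw [γ_apply, contr_extendOne_op_smul, γ_apply, d_val_smul]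

section DualBasis

variable {n : ℕ} {e : Fin n → DegreeOne φ} {f : Fin n → RightDual k (DegreeOne φ)}
  (hef : ∀ x, ∑ j, MulOpposite.op (f j x) • e j = x)

include hef in
theorem apply_eq_sum (g : RightDual k (DegreeOne φ)) : g = ∑ j, g (e j) • f j := by
  ext x
  have hsum : (∑ j, g (e j) • f j) x = ∑ j, g (e j) * f j x :=
    map_sum (AddMonoidHom.mk' (fun h : RightDual k (DegreeOne φ) => h x) fun _ _ => rfl) _ _
  rw [hsum]
  conv_lhs => rw [← hef x, map_sum]
  exact Finset.sum_congr rfl fun j _ => g.map_op_smul _ _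

include hef in
theorem eq_sum_contr {i : ℕ} {p : L.P i} (hp : p ∈ L.deg i (1 + i)) :
    p = ∑ j, DegreeOne.incl φ (e j) • Gen.val L φ i (L.contr φ i 1 (extendOne φ (f j)) p) := by
  conv_lhs => rw [← L.sum_proj_sec φ hp]
  simp only [contr_apply, Finsupp.sum, map_sum, Finset.smul_sum]
  rw [Finset.sum_comm]
  refine Finset.sum_congr rfl fun w _ => ?_
  simp only [Gen.val_smul, smul_smul, extendOne_apply, projOne_proj]
  rw [← Finset.sum_smul]
  congr 1
  conv_lhs => rw [← incl_projOne φ, ← hef (projOne φ _), map_sum]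
  rfl

include hef in
theorem d_eq_sum {i : ℕ} (v : L.Gen φ (i + 1)) : L.d i (Gen.val L φ (i + 1) v) =
    ∑ j, DegreeOne.incl φ (e j) • Gen.val L φ i (L.γ φ i (f j) v) :=
  L.eq_sum_contr φ hef (by rw [add_comm]; exact L.d_mem _ _ _ (Gen.val_mem v))

include hef in
theorem γ_eq_zero {i : ℕ} (v : L.Gen φ (i + 1)) (h : ∀ g, L.γ φ i g v = 0) : v = 0 := by
  ext
  rw [map_zero]
  refine L.eq_zero_of_d_eq_zero (Gen.val_mem v) ?_
  rw [L.d_eq_sum φ hef]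
  exact Finset.sum_eq_zero fun j _ => by rw [h, map_zero, smul_zero]

/-- The contraction of `∑ e_j v_j` with `g` is `∑ g(e_j) v_j`. -/
theorem contr_sum {i : ℕ} (e : Fin n → DegreeOne φ) (v : Fin n → L.Gen φ i)
    (g : RightDual k (DegreeOne φ)) : L.contr φ i 1 (extendOne φ g)
      (∑ j, DegreeOne.incl φ (e j) • Gen.val L φ i (v j)) = ∑ j, g (e j) • v j := by
  rw [map_sum]
  refine Finset.sum_congr rfl fun j _ => ?_
  rw [L.contr_smul_val φ (extendOne_mul_structMap φ g) (DegreeOne.incl_mem _), extendOne_incl]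

include hef in
theorem γ_eq_sum {i : ℕ} (v : L.Gen φ (i + 1)) (g : RightDual k (DegreeOne φ)) :
    L.γ φ i g v = ∑ j, g (e j) • L.γ φ i (f j) v := by
  rw [γ_apply, L.d_eq_sum φ hef, contr_sum]

include hef in
theorem contract_γ_eq_sum {i : ℕ} (v : L.Gen φ (i + 2))
    (τ : RightDual k (DegreeOne φ) ⊗[𝕜] RightDual k (DegreeOne φ)) :
    contract (L.γ φ i) ((L.γ φ (i + 1)).flip v) τ = ∑ j, ∑ l, pairing τ (e j ⊗ₜ e l) •
      L.γ φ i (f l) (L.γ φ (i + 1) (f j) v) := by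
  induction τ with
  | zero => simp
  | add x y hx hy =>
    simp only [map_add, hx, hy, LinearMap.add_apply, add_smul, Finset.sum_add_distrib]
  | tmul g h =>
    rw [contract_tmul, LinearMap.flip_apply, L.γ_eq_sum φ hef v h, map_sum]
    refine Finset.sum_congr rfl fun j _ => ?_
    rw [← γ_op_smul, L.γ_eq_sum φ hef]
    rfl

include hef in
theorem contr_two_d {i : ℕ} (v : Fin n → L.Gen φ (i + 1)) {ψ : A →+ k}
    (hψ : ∀ a r, ψ (a * structMap φ r) = ψ a * r) :
    L.contr φ i 2 ψ (L.d i (∑ j, DegreeOne.incl φ (e j) • Gen.val L φ (i + 1) (v j))) =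
      ∑ j, ∑ l, ψ (DegreeOne.incl φ (e j) * DegreeOne.incl φ (e l)) • L.γ φ i (f l) (v j) := by
  rw [map_sum, map_sum]
  refine Finset.sum_congr rfl fun j _ => ?_
  rw [map_smul, L.d_eq_sum φ hef, Finset.smul_sum, map_sum]
  refine Finset.sum_congr rfl fun l _ => ?_
  rw [smul_smul, L.contr_smul_val φ hψ]
  exact SetLike.mul_mem_graded (DegreeOne.incl_mem _) (DegreeOne.incl_mem _)

-- The relations come from `d² = 0`: the contraction of `τ` with two steps of `γ` is the contraction
-- of `d (d v)` with the functional that `τ` induces on `A₁A₁`.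
include hef in
theorem contract_γ_eq_zero [IsSemisimpleRing k] {i : ℕ} (v : L.Gen φ (i + 2))
    {τ : RightDual k (DegreeOne φ) ⊗[𝕜] RightDual k (DegreeOne φ)}
    (hτ : τ ∈ perp (k := k) (quadraticRelations φ)) :
    contract (L.γ φ i) ((L.γ φ (i + 1)).flip v) τ = 0 := by
  obtain ⟨ψ, hψ, hψτ⟩ := exists_extension_of_mem_perp φ hτ
  rw [L.contract_γ_eq_sum φ hef]
  simp only [← hψτ]
  rw [← L.contr_two_d φ hef _ hψ, ← L.d_eq_sum φ hef, (L.exact_succ i).apply_apply_eq_zero,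
    map_zero]

-- The element `∑ e_j u(f_j)` of `P 0` has degree one, so the augmentation kills it, and exactness
-- at `P 0` provides the preimage `v`.
include hef in
theorem exists_γ_eq_zero (u : RightDual k (DegreeOne φ) →ₗ[𝕜] L.Gen φ 0)
    (hu : ∀ (a : k) g, u (a • g) = a • u g) : ∃ v, ∀ g, L.γ φ 0 g v = u g := by
  let t := ∑ j, DegreeOne.incl φ (e j) • Gen.val L φ 0 (u (f j))
  have ht : t ∈ L.deg 0 1 := AddSubgroup.sum_mem _ fun j _ =>
    L.smul_mem 0 1 0 _ _ (DegreeOne.incl_mem _) (Gen.val_mem _)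
  obtain ⟨y, hy, hyt⟩ := L.exists_preimage_of_ε_eq_zero ht (by
    obtain ⟨a, ha, h⟩ := L.ε_mem 1 t ht
    rw [h]
    refine (Submodule.Quotient.mk_eq_zero _).2 ?_
    change GradedRing.proj 𝒜 0 a = 0
    rw [GradedRing.proj_apply, DirectSum.decompose_of_mem_ne _ ha one_ne_zero])
  refine ⟨(⟨y, hy⟩ : L.deg 1 1), fun g => ?_⟩
  change L.contr φ 0 1 (extendOne φ g) (L.d 0 y) = _
  rw [hyt, contr_sum]
  conv_rhs => rw [apply_eq_sum φ hef g, map_sum]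
  exact Finset.sum_congr rfl fun j _ => (hu _ _).symm

-- Exactness at `P (i + 1)` applied to `t = ∑ e_j u(f_j)`: the equations for `u` say exactly that `d
-- t = 0`, and the preimage of `t` in degree `i + 2` is a generator of `P (i + 2)`.
include hef in
theorem exists_γ_eq [IsSemisimpleRing k] (i : ℕ)
    (u : RightDual k (DegreeOne φ) →ₗ[𝕜] L.Gen φ (i + 1))
    (hu : ∀ (a : k) g, u (a • g) = a • u g)
    (hτ : ∀ τ ∈ perp (k := k) (quadraticRelations φ), contract (L.γ φ i) u τ = 0) :
    ∃ v, ∀ g, L.γ φ (i + 1) g v = u g := by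
  let t := ∑ j, DegreeOne.incl φ (e j) • Gen.val L φ (i + 1) (u (f j))
  have ht : t ∈ L.deg (i + 1) (1 + (i + 1)) := AddSubgroup.sum_mem _ fun j _ =>
    L.smul_mem _ 1 _ _ _ (DegreeOne.incl_mem _) (Gen.val_mem _)
  have hdt : L.d i t = 0 := by
    refine L.eq_zero_of_contr_eq_zero φ (m := 2) ?_ fun ψ hψ => ?_
    · rw [show 2 + i = 1 + (i + 1) by ring]
      exact L.d_mem _ _ _ ht
    -- `∑ G_j ⊗ f_j` is the tensor that represents `ψ` composed with multiplication `A₁ ⊗ A₁ → A₂`.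
    -- It vanishes on `Q`, so the assumption on `u` applies to it.
    · let G (j : Fin n) : RightDual k (DegreeOne φ) :=
        ({ toFun := fun x => ψ (DegreeOne.incl φ (e j) * DegreeOne.incl φ x)
           map_add' := fun x y => by rw [map_add, mul_add, map_add]
           map_smul' := fun r x => by
            refine Eq.trans ?_ (hψ _ r.unop)
            rw [mul_assoc]
            rfl } : DegreeOne φ →ₗ[kᵐᵒᵖ] k)
      have hG : ∀ j x, G j x = ψ (DegreeOne.incl φ (e j) * DegreeOne.incl φ x) := fun _ _ => rfl
      have hpair : ∀ q, pairing (∑ j, G j ⊗ₜ[𝕜] f j) q = ψ ((LinearMap.mul' 𝕜 A ∘ₗ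
          TensorProduct.map (DegreeOne.incl φ) (DegreeOne.incl φ)) q) := fun q => by
        induction q with
        | zero => simp
        | add x y hx hy => rw [map_add, hx, hy, map_add, map_add]
        | tmul x y =>
          change _ = ψ (DegreeOne.incl φ x * DegreeOne.incl φ y)
          conv_rhs => rw [← hef x, map_sum, Finset.sum_mul, map_sum]
          rw [map_sum, LinearMap.sum_apply]
          refine Finset.sum_congr rfl fun j _ => ?_
          rw [DegreeOne.incl_op_smul, mul_assoc]
          rfl
      have h0 := hτ (∑ j, G j ⊗ₜ[𝕜] f j) fun q hq => by
        rw [hpair, LinearMap.mem_ker.1 hq, map_zero]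
      rw [map_sum] at h0
      rw [L.contr_two_d φ hef _ hψ, ← h0]
      refine Finset.sum_congr rfl fun j _ => ?_
      rw [contract_tmul, L.γ_eq_sum φ hef]
      rfl
  obtain ⟨y, hy, hyt⟩ := L.exists_preimage_of_d_eq_zero ht hdt
  rw [add_comm 1] at hy
  refine ⟨(⟨y, hy⟩ : L.deg (i + 1 + 1) (i + 1 + 1)), fun g => ?_⟩
  change L.contr φ (i + 1) 1 (extendOne φ g) (L.d (i + 1) y) = _
  rw [hyt, contr_sum]
  conv_rhs => rw [apply_eq_sum φ hef g, map_sum]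
  exact Finset.sum_congr rfl fun j _ => (hu _ _).symm

end DualBasis

/-- The degree `n` component of the quadratic dual vanishes if and only if the `n`-th term of a
linear resolution does. -/
theorem quadraticDual_component_eq_bot_iff [IsSemisimpleRing k]
    [Module.Finite kᵐᵒᵖ (DegreeOne φ)] (n : ℕ) :
    QuadraticDual.component φ n = ⊥ ↔ ∀ v ∈ L.deg n n, v = 0 := by
  obtain ⟨m, e, f, hef⟩ := exists_finite_dualBasis (k := k) (E := DegreeOne φ)
  obtain ⟨v₀, hv₀, hε⟩ := L.exists_deg_zero_lift
  let w₀ : L.Gen φ 0 := (⟨v₀, hv₀⟩ : L.deg 0 0)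
  -- `k` embeds in `V_0`: the augmentation maps `r w₀` to the class of `r`, and `A₀` meets `A_{>0}`
  -- in zero.
  have hj : Function.Injective (LinearMap.toSpanSingleton k (L.Gen φ 0) w₀) := by
    rw [injective_iff_map_eq_zero]
    intro r hr
    have h1 : structMap φ r • v₀ = 0 := congrArg (Gen.val L φ 0) hr
    have h2 := congrArg L.ε h1
    rw [map_smul, hε, ← map_smul, smul_eq_mul, mul_one, map_zero] at h2
    have h3 : GradedRing.proj 𝒜 0 (structMap φ r) = 0 := (Submodule.Quotient.mk_eq_zero _).1 h2
    rw [GradedRing.proj_apply, DirectSum.decompose_of_mem_same _ (structMap_mem φ r)] at h3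
    exact structMap_injective φ (h3.trans (map_zero _).symm)
  refine (quadraticRing_component_eq_bot_iff (L.γ φ) (L.γ_smul φ) (L.γ_op_smul φ)
    (fun i v τ hτ => L.contract_γ_eq_zero φ hef v hτ) (fun i v => L.γ_eq_zero φ hef v)
    (L.exists_γ_eq_zero φ hef) (L.exists_γ_eq φ hef) _ hj n).trans ?_
  exact ⟨fun h v hv => congrArg Subtype.val (h ⟨v, hv⟩), fun h v => Subtype.ext (h v.1 v.2)⟩

end LinearResolution

end KoszulDual

end

/-! ### Comparison of global dimensions and conclusion. -/

noncomputable section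

namespace KoszulDual

universe u

open CategoryTheory

theorem leftGlobalDimension_le_iff (R : Type u) [Ring R] (n : ℕ) : leftGlobalDimension R ≤ n ↔
    ∀ M : ModuleCat.{u} R, HasProjectiveDimensionLT M (n + 1) := by
  simp only [leftGlobalDimension, iSup_le_iff, projectiveDimension_le_iff]

theorem leftGlobalDimension_eq_bot_iff (R : Type u) [Ring R] :
    leftGlobalDimension R = ⊥ ↔ Subsingleton R := by
  simp only [leftGlobalDimension, iSup_eq_bot, projectiveDimension_eq_bot_iff,
    ModuleCat.isZero_iff_subsingleton]
  exact ⟨fun h => h (ModuleCat.of R R), fun _ M => Module.subsingleton R M⟩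

/-- The hypotheses combine to `G < n ↔ V n` for all `n`; the value `⊥`, taken for the zero ring,
covers `n = 0`. -/
theorem eq_natCast_iff {G : WithBot ℕ∞} {V : ℕ → Prop} (hle : ∀ n : ℕ, G ≤ n ↔ V (n + 1))
    (hbot : G = ⊥ ↔ V 0) (n : ℕ) : G = n ↔ ¬ V n ∧ ∀ i > n, V i := by
  have hlt : ∀ n : ℕ, G < n ↔ V n := by
    rintro (_ | n)
    · rw [Nat.cast_zero, WithBot.lt_zero_iff_eq_bot, hbot]
    · rw [← hle, Nat.cast_add, Nat.cast_one, ENat.WithBot.lt_add_one_iff]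
  rw [← hlt n, not_lt]
  constructor
  · rintro rfl
    exact ⟨le_rfl, fun i hi => (hlt i).1 (by exact_mod_cast hi)⟩
  · rintro ⟨h1, h2⟩
    exact le_antisymm ((hle n).2 (h2 _ (Nat.lt_succ_self n))) h1

namespace NatGrading

/-- The grading of a graded algebra. -/
def ofGradedAlgebra {𝕜 A : Type*} [Field 𝕜] [Ring A] [Algebra 𝕜 A] (𝒜 : ℕ → Submodule 𝕜 A)
    [GradedAlgebra 𝒜] : NatGrading A where
  proj := GradedRing.proj 𝒜
  proj_proj i j x := by
    rw [GradedRing.proj_apply, GradedRing.proj_apply]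
    split_ifs with h
    · rw [h, DirectSum.decompose_of_mem_same _ (SetLike.coe_mem _)]
    · rw [DirectSum.decompose_of_mem_ne _ (SetLike.coe_mem _) (Ne.symm h)]
  proj_mul n a b := by
    refine DirectSum.Decomposition.inductionOn 𝒜 (motive := fun a => GradedRing.proj 𝒜 n (a * b) =
      ∑ p ∈ Finset.HasAntidiagonal.antidiagonal n,
        GradedRing.proj 𝒜 p.1 a * GradedRing.proj 𝒜 p.2 b) (by simp) ?_ ?_ a
    · intro i a
      have h : ∀ p ∈ Finset.HasAntidiagonal.antidiagonal n, p.1 ≠ i →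
          GradedRing.proj 𝒜 p.1 (a : A) * GradedRing.proj 𝒜 p.2 b = 0 := fun p _ hne => by
        rw [GradedRing.proj_apply, DirectSum.decompose_of_mem_ne _ a.2 (Ne.symm hne), zero_mul]
      rw [GradedRing.proj_apply]
      by_cases hi : i ≤ n
      · rw [DirectSum.coe_decompose_mul_of_left_mem_of_le 𝒜 a.2 hi,
          Finset.sum_eq_single (i, n - i)]
        · simp only
          rw [GradedRing.proj_apply, DirectSum.decompose_of_mem_same _ a.2, GradedRing.proj_apply]
        · intro p hp hne
          refine h p hp fun hpi => hne (Prod.ext hpi ?_)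
          rw [Finset.HasAntidiagonal.mem_antidiagonal] at hp
          simp only
          omega
        · intro hn
          rw [Finset.HasAntidiagonal.mem_antidiagonal] at hn
          simp only at hn
          omega
      · rw [DirectSum.coe_decompose_mul_of_left_mem_of_not_le 𝒜 a.2 hi]
        refine (Finset.sum_eq_zero fun p hp => h p hp ?_).symm
        rw [Finset.HasAntidiagonal.mem_antidiagonal] at hp
        omega
    · intro x y hx hy
      simp only [add_mul, map_add, hx, hy, Finset.sum_add_distrib]
  exists_bound x := by
    classical
    refine ⟨(DirectSum.decompose 𝒜 x).support.sup id + 1, fun i hi => ?_⟩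
    rw [GradedRing.proj_apply]
    by_contra h
    have := Finset.le_sup (f := id) (DFinsupp.mem_support_iff.2 fun h' => h (by rw [h']; rfl) :
      i ∈ (DirectSum.decompose 𝒜 x).support)
    simp only [id] at this
    omega
  eq_zero x hx := by
    classical
    rw [← DirectSum.sum_support_decompose 𝒜 x]
    exact Finset.sum_eq_zero fun i _ => hx i
  proj_zero_one := by
    rw [GradedRing.proj_apply, DirectSum.decompose_of_mem_same _ SetLike.GradedOne.one_mem]

/-- Let `R` be a graded ring whose degree zero component is semisimple. If the left module
`S / S_{>0}` over the opposite ring `S` has projective dimension at most `n`, then all left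
`R`-modules have projective dimension at most `n`. -/
theorem leftGlobalDimension_le_of_opposite {R S : Type u} [Ring R] [Ring S] (g : NatGrading R)
    {K : Type*} [Ring K] [IsSemisimpleRing K] (κ : K →+* R) (hκ : ∀ c, g.proj 0 (κ c) = κ c)
    (hκ' : ∀ r, g.proj 0 r = r → ∃ c, κ c = r) (e : R ≃+* Sᵐᵒᵖ) (I : Ideal S)
    (hI : ∀ r, r ∈ g.pos ↔ (e r).unop ∈ I) {n : ℕ}
    (hX : HasProjectiveDimensionLT (ModuleCat.of S (S ⧸ I)) (n + 1)) :
    leftGlobalDimension R ≤ n := by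
  let : Module K R := Module.compHom R κ
  have hsmul : ∀ (c : K) (r : R), c • r = κ c * r := fun _ _ => rfl
  have : IsScalarTower K R R := ⟨fun c a b => by
    rw [hsmul, hsmul, smul_eq_mul, smul_eq_mul, mul_assoc]⟩
  rw [leftGlobalDimension_le_iff]
  intro M
  refine g.hasProjectiveDimensionLT_of_opposite (K := K)
    (fun c => by rw [hsmul, mul_one, hκ])
    (fun r hr => (hκ' r hr).imp fun c hc => by rw [hsmul, mul_one, hc])
    e (x₀ := I.mkQ 1) (fun x => ?_) (fun r hr x => ?_) (fun s hs => ?_) n hX M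
  · obtain ⟨s, rfl⟩ := I.mkQ_surjective x
    exact ⟨s, by rw [← map_smul, smul_eq_mul, mul_one]⟩
  · obtain ⟨t, rfl⟩ := I.mkQ_surjective x
    rw [← map_smul]
    refine (Submodule.Quotient.mk_eq_zero I).2 ?_
    have h := (hI _).1 (g.pos.mul_mem_left (e.symm (MulOpposite.op t)) hr)
    rwa [map_mul, RingEquiv.apply_symm_apply, MulOpposite.unop_mul, MulOpposite.unop_op] at h
  · rw [← map_smul, smul_eq_mul, mul_one] at hs
    rw [hI, RingEquiv.apply_symm_apply]
    exact (Submodule.Quotient.mk_eq_zero I).1 hs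

end NatGrading

section Connected

variable {𝕜 k : Type*} {A : Type u} [Field 𝕜] [Ring k] [Algebra 𝕜 k] [IsSemisimpleRing k]
  [Ring A] [Algebra 𝕜 A] {𝒜 : ℕ → Submodule 𝕜 A} [GradedAlgebra 𝒜]

theorem rightGlobalDimension_le_of_hasProjectiveDimensionLT (φ : k ≃ₐ[𝕜] 𝒜 0) {n : ℕ}
    (h : HasProjectiveDimensionLT (ModuleCat.of A (A ⧸ positivePart 𝒜)) (n + 1)) :
    rightGlobalDimension A ≤ n := by
  refine (NatGrading.ofGradedAlgebra 𝒜).op.leftGlobalDimension_le_of_opposite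
    (structMap φ).op (fun c => ?_) (fun r hr => ?_) (RingEquiv.refl _) (positivePart 𝒜)
    (fun r => MulOpposite.op_eq_zero_iff _) h
  · exact congrArg MulOpposite.op ((GradedRing.proj_apply 𝒜 0 _).trans
      (DirectSum.decompose_of_mem_same 𝒜 (structMap_mem φ c.unop)))
  · have h0 : GradedRing.proj 𝒜 0 r.unop = r.unop := congrArg MulOpposite.unop hr
    obtain ⟨c, hc⟩ := exists_structMap_eq φ (a := r.unop) (h0 ▸ SetLike.coe_mem _)
    exact ⟨MulOpposite.op c, congrArg MulOpposite.op hc⟩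

/-- The criterion with the roles of `A` and its opposite exchanged; the right module `A / A_{>0}`
has projective dimension at most `n` because all right modules do. With the preceding bound this
closes the circle from the left module `A / A_{>0}` back to all left modules. -/
theorem leftGlobalDimension_le_of_rightGlobalDimension_le (φ : k ≃ₐ[𝕜] 𝒜 0) {n : ℕ}
    (h : rightGlobalDimension A ≤ n) : leftGlobalDimension A ≤ n := by
  refine (NatGrading.ofGradedAlgebra 𝒜).leftGlobalDimension_le_of_opposite
    (structMap φ) (fun c => ?_) (fun r hr => ?_) (RingEquiv.opOp A)
    (NatGrading.ofGradedAlgebra 𝒜).op.pos (fun r => (MulOpposite.op_eq_zero_iff _).symm)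
    ((leftGlobalDimension_le_iff _ n).1 h _)
  · exact (GradedRing.proj_apply 𝒜 0 _).trans
      (DirectSum.decompose_of_mem_same 𝒜 (structMap_mem φ c))
  · have h0 : GradedRing.proj 𝒜 0 r = r := hr
    exact exists_structMap_eq φ (h0 ▸ SetLike.coe_mem _)

variable (L : LinearResolution 𝒜)

include L in
theorem LinearResolution.subsingleton_iff : Subsingleton A ↔ ∀ v ∈ L.deg 0 0, v = 0 := by
  constructor
  · intro _ v _
    have := Module.subsingleton A (L.P 0)
    exact Subsingleton.elim _ _
  · intro h
    obtain ⟨x, hx⟩ := L.ε_surjective ((positivePart 𝒜).mkQ 1)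
    rw [L.eq_zero_of_deg_eq_zero h x, map_zero] at hx
    have h1 : GradedRing.proj 𝒜 0 1 = 0 := (Submodule.Quotient.mk_eq_zero _).1 hx.symm
    rw [GradedRing.proj_apply, DirectSum.decompose_of_mem_same _ SetLike.GradedOne.one_mem] at h1
    exact subsingleton_of_zero_eq_one h1.symm

theorem LinearResolution.leftGlobalDimension_le_iff (φ : k ≃ₐ[𝕜] 𝒜 0) (n : ℕ) :
    leftGlobalDimension A ≤ n ↔ ∀ v ∈ L.deg (n + 1) (n + 1), v = 0 := by
  rw [← L.hasProjectiveDimensionLT_iff]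
  exact ⟨fun h => (KoszulDual.leftGlobalDimension_le_iff A n).1 h _, fun h =>
    leftGlobalDimension_le_of_rightGlobalDimension_le φ
      (rightGlobalDimension_le_of_hasProjectiveDimensionLT φ h)⟩

theorem LinearResolution.rightGlobalDimension_le_iff (φ : k ≃ₐ[𝕜] 𝒜 0) (n : ℕ) :
    rightGlobalDimension A ≤ n ↔ ∀ v ∈ L.deg (n + 1) (n + 1), v = 0 := by
  rw [← L.hasProjectiveDimensionLT_iff]
  exact ⟨fun h => (KoszulDual.leftGlobalDimension_le_iff A n).1
      (leftGlobalDimension_le_of_rightGlobalDimension_le φ h) _,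
    rightGlobalDimension_le_of_hasProjectiveDimensionLT φ⟩

end Connected

end KoszulDual

end

theorem mainTheorem8 {𝕜 k A : Type*}
    [Field 𝕜]
    [Ring k] [Algebra 𝕜 k] [Module.Finite 𝕜 k] [IsSemisimpleRing k]
    [Ring A] [Algebra 𝕜 A] (𝒜 : ℕ → Submodule 𝕜 A) [GradedAlgebra 𝒜] (φ : k ≃ₐ[𝕜] 𝒜 0)
    [Module.Finite k (KoszulDual.DegreeOne φ)] [Module.Finite kᵐᵒᵖ (KoszulDual.DegreeOne φ)]
    (hA : KoszulDual.IsKoszul 𝒜) (n : ℕ) :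
    (KoszulDual.leftGlobalDimension A = n ↔
      KoszulDual.QuadraticDual.component φ n ≠ ⊥ ∧
        ∀ i > n, KoszulDual.QuadraticDual.component φ i = ⊥) ∧
    (KoszulDual.rightGlobalDimension A = n ↔
      KoszulDual.QuadraticDual.component φ n ≠ ⊥ ∧
        ∀ i > n, KoszulDual.QuadraticDual.component φ i = ⊥) := by
  obtain ⟨L⟩ := hA
  have h := L.quadraticDual_component_eq_bot_iff φ
  constructor
  · refine KoszulDual.eq_natCast_iff
      (V := fun i => KoszulDual.QuadraticDual.component φ i = ⊥) (fun n => ?_) ?_ n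
    · rw [h, L.leftGlobalDimension_le_iff φ]
    · rw [h, KoszulDual.leftGlobalDimension_eq_bot_iff, L.subsingleton_iff]
  · refine KoszulDual.eq_natCast_iff
      (V := fun i => KoszulDual.QuadraticDual.component φ i = ⊥) (fun n => ?_) ?_ n
    · rw [h, L.rightGlobalDimension_le_iff φ]
    · rw [h, ← L.subsingleton_iff]
      exact (KoszulDual.leftGlobalDimension_eq_bot_iff Aᵐᵒᵖ).trans
        MulOpposite.opEquiv.subsingleton_congr.symm
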